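/- Let $n\ge 2$ and let $A=(a_{ij})_{i,j=0}^n$ and $A'=(a'_{ij})_{i,j=0}^n$ be matrices of nonnegative integers. Write $F_A=\sum_{i=0}^n\prod_{j=0}^n x_j^{a_{ij}}\in\mathbb{C}[x_0,\dots,x_n]$. Assume that $A$ is invertible over $\mathbb{Q}$; that there are positive integers $q_0,\dots,q_n,d$ with $\sum_j a_{ij}q_j=d$ for all $i$ and $\sum_j q_j=d$; and that the affine hypersurface $F_A=0$ in $\mathbb{C}^{n+1}$ has exactly one singular point, the origin (singular meaning that $F_A$ and all its partial derivatives vanish). Assume the same for $A'$, with positive integers $q'_0,\dots,q'_n,d'$; the weights $q$ and $q'$ need not agree. Let $\mathrm{Aut}(F_A)$ be the group of all $\lambda\in(\mathbb{C}^*)^{n+1}$ such that $F_A(\lambda_0x_0,\dots,\lambda_nx_n)=F_A(x_0,\dots,x_n)$ for all $x\in\mathbb{C}^{n+1}$, let $SL(F_A)=\{\lambda\in \mathrm{Aut}(F_A):\prod_j\lambda_j=1\}$, and let $J_{F_A}=\mathrm{Aut}(F_A)\cap\{(t^{q_0},\dots,t^{q_n}):t\in\mathbb{C}^*\}$; define the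 groups for $A'$ in the same way, with weights $q'$. Let $G$ and $G'$ be subgroups of $(\mathbb{C}^*)^{n+1}$ with $J_{F_A}\subseteq G\subseteq SL(F_A)$ and $J_{F_{A'}}\subseteq G'\subseteq SL(F_{A'})$. The dual group of $G$ is $$G^T=\Big\{\prod_{i=0}^n(\rho_i^T)^{s_i}\ :\ s\in\mathbb{Z}^{n+1},\ \prod_{i=0}^n x_i^{s_i}\text{ is }G\text{-invariant}\Big\}\subseteq\mathrm{Aut}(F_{A^T}),\qquad \rho_i^T=\big(e^{2\pi\sqrt{-1}\,(A^{-1})_{ij}}\big)_{j=0}^n,$$ and $(G')^T$ is defined in the same way from $A'$ and $G'$. Then there are positive integers $r_0,\dots,r_n,e$ with $\sum_j a_{ji}r_j=e$ for all $i$, and likewise positive integers $r'_0,\dots,r'_n,e'$ for $A'$. For any such choice, let $X_{A^T}=\{F_{A^T}=0\}\subseteq W\mathbb{P}^n(r_0,\dots,r_n)$ and let $Z_{A^T,G^T}=X_{A^T}/\tilde G^T$ with $\tilde G^T=G^T/J_{F_{A^T}}$ (this is the quotient of $X_{A^T}$ by $G^T$, as $J_{F_{A^T}}$ acts trivially), a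 scheme over $\mathbb{C}$; define $Z_{(A')^T,(G')^T}$ in the same way from $A'$, $G'$ and $r'$. If $G=G'$, then $Z_{A^T,G^T}$ and $Z_{(A')^T,(G')^T}$ are birational over $\mathbb{C}$. -/

import Mathlib

open MvPolynomial AlgebraicGeometry CategoryTheory

namespace BHK

noncomputable section

/-! ### Gradings -/

/-- A family of submodules closed under multiplication, spanning, and equipped with linear
projections onto its members, is a grading. -/
abbrev gradedAlgebraOfProj {S : Type} [CommRing S] [Algebra ℂ S] (𝒮 : ℕ → Submodule ℂ S)
    (hm : SetLike.GradedMonoid 𝒮) (P : ℕ → S →ₗ[ℂ] S)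
    (hsame : ∀ k, ∀ s ∈ 𝒮 k, P k s = s) (hne : ∀ k l, k ≠ l → ∀ s ∈ 𝒮 l, P k s = 0)
    (htop : ⨆ k, 𝒮 k = ⊤) : GradedAlgebra 𝒮 :=
  have hint : DirectSum.IsInternal 𝒮 := by
    rw [DirectSum.isInternal_submodule_iff_iSupIndep_and_iSup_eq_top]
    refine ⟨fun k => ?_, htop⟩
    rw [Submodule.disjoint_def]
    intro x hx hx'
    have hle : (⨆ l, ⨆ (_ : l ≠ k), 𝒮 l) ≤ LinearMap.ker (P k) :=
      iSup₂_le fun l hl s hs => hne k l hl.symm s hs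
    rw [← hsame k x hx]
    exact hle hx'
  { toGradedMonoid := hm
    toDecomposition := hint.chooseDecomposition }

variable {n : ℕ}

/-! ### Invertible potentials -/

/-- The polynomial `F_A = ∑ i, ∏ j, x_j ^ a_ij`. -/
def potential (A : Matrix (Fin (n + 1)) (Fin (n + 1)) ℕ) : MvPolynomial (Fin (n + 1)) ℂ :=
  ∑ i, ∏ j, X j ^ A i j

/-- The matrix of exponents with entries regarded as rational numbers. -/
abbrev ratMatrix (A : Matrix (Fin (n + 1)) (Fin (n + 1)) ℕ) :
    Matrix (Fin (n + 1)) (Fin (n + 1)) ℚ :=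
  A.map (Nat.cast : ℕ → ℚ)

/-- Positive integers `q_j`, `d` with `∑ j, a_ij q_j = d` for all `i`: the polynomial `F_A` is
quasihomogeneous of degree `d` for the weights `q_j`. -/
structure IsWeightSystem (A : Matrix (Fin (n + 1)) (Fin (n + 1)) ℕ) (q : Fin (n + 1) → ℕ)
    (d : ℕ) : Prop where
  weight_pos : ∀ j, 0 < q j
  degree_pos : 0 < d
  sum_eq : ∀ i, ∑ j, A i j * q j = d

/-- The singular points of the affine hypersurface `F = 0` in `ℂ^(n+1)`. -/
def affineSingularLocus (F : MvPolynomial (Fin (n + 1)) ℂ) : Set (Fin (n + 1) → ℂ) :=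
  {x | eval x F = 0 ∧ ∀ j, eval x (pderiv j F) = 0}

/-- `F_A` is an invertible non-degenerate potential, quasihomogeneous of degree `d` with weights
`q_j`, and satisfies the Calabi-Yau condition `∑ j, q_j = d`. -/
structure IsCalabiYauPotential (A : Matrix (Fin (n + 1)) (Fin (n + 1)) ℕ)
    (q : Fin (n + 1) → ℕ) (d : ℕ) : Prop where
  det_ne_zero : (ratMatrix A).det ≠ 0
  isWeightSystem : IsWeightSystem A q d
  nondegenerate : affineSingularLocus (potential A) = {0}
  calabiYau : ∑ j, q j = d

/-! ### Groups of diagonal symmetries, as subgroups of the torus `(ℂˣ)^(n+1)` -/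

/-- The group `Aut(F_A)` of diagonal automorphisms. -/
def diagAut (A : Matrix (Fin (n + 1)) (Fin (n + 1)) ℕ) : Subgroup (Fin (n + 1) → ℂˣ) where
  carrier := {l | ∀ x : Fin (n + 1) → ℂ,
    eval (fun j => (l j : ℂ) * x j) (potential A) = eval x (potential A)}
  mul_mem' {l m} hl hm x := by
    have := hl (fun j => (m j : ℂ) * x j)
    simp only [← mul_assoc] at this
    simpa [hm x] using this
  one_mem' x := by simp
  inv_mem' {l} hl x := by
    have := hl (fun j => ((l j)⁻¹ : ℂˣ) * x j)
    simpa using this.symm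

/-- The group `SL(F_A)` of the elements of `Aut(F_A)` with product of entries equal to `1`. -/
def diagSL (A : Matrix (Fin (n + 1)) (Fin (n + 1)) ℕ) : Subgroup (Fin (n + 1) → ℂˣ) where
  carrier := {l | l ∈ diagAut A ∧ ∏ j, l j = 1}
  mul_mem' hl hm := ⟨mul_mem hl.1 hm.1, by simp [Finset.prod_mul_distrib, hl.2, hm.2]⟩
  one_mem' := ⟨one_mem _, by simp⟩
  inv_mem' hl := ⟨inv_mem hl.1, by simp [hl.2]⟩

/-- The one-parameter group `{(t^q_0, …, t^q_n)}` of the torus, whose quotient is the weighted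
projective space with weights `q`. -/
def weightTorus (q : Fin (n + 1) → ℕ) : Subgroup (Fin (n + 1) → ℂˣ) :=
  MonoidHom.range
    { toFun := fun (t : ℂˣ) (j : Fin (n + 1)) => t ^ q j
      map_one' := by ext; simp
      map_mul' := fun s t => by ext; simp [mul_pow] }

/-- The group `J_{F_A} = Aut(F_A) ∩ ℂˣ`. -/
def groupJ (A : Matrix (Fin (n + 1)) (Fin (n + 1)) ℕ) (q : Fin (n + 1) → ℕ) :
    Subgroup (Fin (n + 1) → ℂˣ) :=
  diagAut A ⊓ weightTorus q

/-- The element `ρ_i = (exp(2πi b_0i/d), …, exp(2πi b_ni/d))`, where `b_ji/d` is the `(j, i)` entry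
of the inverse matrix of `A`. -/
def rho (A : Matrix (Fin (n + 1)) (Fin (n + 1)) ℕ) (i : Fin (n + 1)) : Fin (n + 1) → ℂˣ :=
  fun j => Units.mk0 (Complex.exp (2 * Real.pi * Complex.I * (((ratMatrix A)⁻¹ j i : ℚ) : ℂ)))
    (Complex.exp_ne_zero _)

/-- The dual group `G^T`: the products `∏ i, (ρ_i^T)^(s_i)`, with `ρ_i^T` the elements `ρ_i` of the
transposed matrix, over all integer vectors `s` such that the Laurent monomial `∏ i, x_i^(s_i)` is
`G`-invariant. An element `g` of the torus multiplies this monomial by `∏ i, g_i^(s_i)`. -/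
def dualGroup (A : Matrix (Fin (n + 1)) (Fin (n + 1)) ℕ) (G : Subgroup (Fin (n + 1) → ℂˣ)) :
    Subgroup (Fin (n + 1) → ℂˣ) where
  carrier := {l | ∃ s : Fin (n + 1) → ℤ,
    (∀ g ∈ G, ∏ i, g i ^ s i = 1) ∧ l = ∏ i, rho A.transpose i ^ s i}
  mul_mem' := by
    rintro _ _ ⟨s, hs, rfl⟩ ⟨t, ht, rfl⟩
    exact ⟨s + t, fun g hg => by simp [zpow_add, Finset.prod_mul_distrib, hs g hg, ht g hg],
      by simp [zpow_add, Finset.prod_mul_distrib]⟩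
  one_mem' := ⟨0, by simp, by simp⟩
  inv_mem' := by
    rintro _ ⟨s, hs, rfl⟩
    exact ⟨-s, fun g hg => by simp [hs g hg], by simp⟩

lemma rho_mem_diagAut {A : Matrix (Fin (n + 1)) (Fin (n + 1)) ℕ} (hA : (ratMatrix A).det ≠ 0)
    (i : Fin (n + 1)) : rho A i ∈ diagAut A := by
  intro x
  simp only [potential, map_sum, map_prod, map_pow, eval_X, mul_pow, Finset.prod_mul_distrib]
  refine Finset.sum_congr rfl fun k _ => ?_
  have h1 : ratMatrix A * (ratMatrix A)⁻¹ = 1 :=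
    Matrix.mul_nonsing_inv _ (isUnit_iff_ne_zero.mpr hA)
  have h2 : ∑ j, (A k j : ℂ) * (((ratMatrix A)⁻¹ j i : ℚ) : ℂ)
      = (((1 : Matrix (Fin (n + 1)) (Fin (n + 1)) ℚ) k i : ℚ) : ℂ) := by
    rw [← h1, Matrix.mul_apply]
    push_cast
    simp
  have h3 : ∏ j, (rho A i j : ℂ) ^ A k j = 1 := by
    simp only [rho, Units.val_mk0, ← Complex.exp_nat_mul, ← Complex.exp_sum]
    have : ∑ j, (A k j : ℂ) * (2 * Real.pi * Complex.I * (((ratMatrix A)⁻¹ j i : ℚ) : ℂ))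
        = (((1 : Matrix (Fin (n + 1)) (Fin (n + 1)) ℚ) k i : ℚ) : ℂ)
          * (2 * Real.pi * Complex.I) := by
      rw [← h2, Finset.sum_mul]
      exact Finset.sum_congr rfl fun j _ => by ring
    rw [this, Matrix.one_apply]
    split_ifs <;> simp [Complex.exp_two_pi_mul_I]
  rw [h3, one_mul]

/-- The dual group consists of diagonal automorphisms of the transposed polynomial. -/
lemma dualGroup_le_diagAut {A : Matrix (Fin (n + 1)) (Fin (n + 1)) ℕ}
    (hA : (ratMatrix A).det ≠ 0) (G : Subgroup (Fin (n + 1) → ℂˣ)) :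
    dualGroup A G ≤ diagAut A.transpose := by
  rintro _ ⟨s, -, rfl⟩
  have hA' : (ratMatrix A.transpose).det ≠ 0 := by
    rw [ratMatrix, Matrix.transpose_map, Matrix.det_transpose]
    exact hA
  exact prod_mem fun i _ => zpow_mem (rho_mem_diagAut hA' i) _

/-! ### The hypersurface `X_A` and its quotients -/

/-- The homogeneous coordinate ring `ℂ[x_0, …, x_n] / (F_A)` of the hypersurface `X_A`. -/
abbrev CoordRing (A : Matrix (Fin (n + 1)) (Fin (n + 1)) ℕ) : Type :=
  MvPolynomial (Fin (n + 1)) ℂ ⧸ Ideal.span {potential A}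

/-- The quotient map `ℂ[x_0, …, x_n] → ℂ[x_0, …, x_n] / (F_A)`. -/
def toCoordRing (A : Matrix (Fin (n + 1)) (Fin (n + 1)) ℕ) :
    MvPolynomial (Fin (n + 1)) ℂ →ₐ[ℂ] CoordRing A :=
  Ideal.Quotient.mkₐ ℂ _

/-- The grading of the coordinate ring in which `x_j` has degree `q_j`. -/
def coordGrading (A : Matrix (Fin (n + 1)) (Fin (n + 1)) ℕ) (q : Fin (n + 1) → ℕ) (k : ℕ) :
    Submodule ℂ (CoordRing A) :=
  (weightedHomogeneousSubmodule ℂ q k).map (toCoordRing A).toLinearMap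

lemma potential_isWeightedHomogeneous {A : Matrix (Fin (n + 1)) (Fin (n + 1)) ℕ}
    {q : Fin (n + 1) → ℕ} {d : ℕ} (h : IsWeightSystem A q d) :
    IsWeightedHomogeneous q (potential A) d := by
  refine IsWeightedHomogeneous.sum _ _ _ fun i _ => ?_
  rw [← h.sum_eq i]
  refine IsWeightedHomogeneous.prod _ _ _ fun j _ => ?_
  simpa using (isWeightedHomogeneous_X ℂ q j).pow (A i j)

/-- The degree `k` component map of the coordinate ring. -/
def coordProj {A : Matrix (Fin (n + 1)) (Fin (n + 1)) ℕ} {q : Fin (n + 1) → ℕ} {d : ℕ}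
    (h : IsWeightSystem A q d) (k : ℕ) : CoordRing A →ₗ[ℂ] CoordRing A :=
  Submodule.mapQ ((Ideal.span {potential A}).restrictScalars ℂ)
    ((Ideal.span {potential A}).restrictScalars ℂ) (weightedHomogeneousComponent q k) <| by
      intro p hp
      let _ := weightedGradedAlgebra ℂ q
      refine weightedHomogeneousComponent_mem_of_mem ℂ q (Ideal.homogeneous_span _ _ ?_) hp k
      rintro _ rfl
      exact ⟨d, potential_isWeightedHomogeneous h⟩

lemma coordProj_toCoordRing {A : Matrix (Fin (n + 1)) (Fin (n + 1)) ℕ} {q : Fin (n + 1) → ℕ}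
    {d : ℕ} (h : IsWeightSystem A q d) (k : ℕ) (p : MvPolynomial (Fin (n + 1)) ℂ) :
    coordProj h k (toCoordRing A p) = toCoordRing A (weightedHomogeneousComponent q k p) :=
  rfl

/-- An element of the coordinate ring is the sum of its components. -/
lemma exists_sum_coordProj {A : Matrix (Fin (n + 1)) (Fin (n + 1)) ℕ} {q : Fin (n + 1) → ℕ}
    {d : ℕ} (h : IsWeightSystem A q d) (s : CoordRing A) :
    ∃ t : Finset ℕ, ∑ k ∈ t, coordProj h k s = s := by
  obtain ⟨p, rfl⟩ : ∃ p, toCoordRing A p = s := Ideal.Quotient.mk_surjective s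
  refine ⟨(weightedHomogeneousComponent_finsupp (w := q) p).toFinset, ?_⟩
  simp only [coordProj_toCoordRing, ← map_sum]
  conv_rhs => rw [← sum_weightedHomogeneousComponent q p]
  rw [finsum_eq_sum _ (weightedHomogeneousComponent_finsupp p)]

lemma coordProj_mem {A : Matrix (Fin (n + 1)) (Fin (n + 1)) ℕ} {q : Fin (n + 1) → ℕ} {d : ℕ}
    (h : IsWeightSystem A q d) (k : ℕ) (s : CoordRing A) :
    coordProj h k s ∈ coordGrading A q k := by
  obtain ⟨p, rfl⟩ : ∃ p, toCoordRing A p = s := Ideal.Quotient.mk_surjective s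
  exact ⟨_, weightedHomogeneousComponent_mem q p k, rfl⟩

lemma coordProj_same {A : Matrix (Fin (n + 1)) (Fin (n + 1)) ℕ} {q : Fin (n + 1) → ℕ} {d : ℕ}
    (h : IsWeightSystem A q d) (k : ℕ) (s : CoordRing A) (hs : s ∈ coordGrading A q k) :
    coordProj h k s = s := by
  obtain ⟨p, hp, rfl⟩ := hs
  exact congrArg (toCoordRing A) (weightedHomogeneousComponent_eq_self hp)

lemma coordProj_ne {A : Matrix (Fin (n + 1)) (Fin (n + 1)) ℕ} {q : Fin (n + 1) → ℕ} {d : ℕ}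
    (h : IsWeightSystem A q d) (k l : ℕ) (hkl : k ≠ l) (s : CoordRing A)
    (hs : s ∈ coordGrading A q l) : coordProj h k s = 0 := by
  obtain ⟨p, hp, rfl⟩ := hs
  exact (congrArg (toCoordRing A)
    (IsWeightedHomogeneous.weightedHomogeneousComponent_ne k hp hkl)).trans (map_zero _)

lemma coordGrading_gradedMonoid (A : Matrix (Fin (n + 1)) (Fin (n + 1)) ℕ)
    (q : Fin (n + 1) → ℕ) : SetLike.GradedMonoid (coordGrading A q) where
  one_mem := ⟨1, isWeightedHomogeneous_one ℂ q, map_one (toCoordRing A)⟩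
  mul_mem := by
    rintro k l _ _ ⟨p, hp, rfl⟩ ⟨r, hr, rfl⟩
    exact ⟨p * r, IsWeightedHomogeneous.mul hp hr, map_mul (toCoordRing A) p r⟩

/-- The substitution `x_j ↦ l_j x_j`. -/
def scale (l : Fin (n + 1) → ℂˣ) :
    MvPolynomial (Fin (n + 1)) ℂ →ₐ[ℂ] MvPolynomial (Fin (n + 1)) ℂ :=
  aeval fun j => C (l j : ℂ) * X j

lemma eval_scale (l : Fin (n + 1) → ℂˣ) (x : Fin (n + 1) → ℂ)
    (p : MvPolynomial (Fin (n + 1)) ℂ) :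
    eval x (scale l p) = eval (fun j => (l j : ℂ) * x j) p := by
  induction p using MvPolynomial.induction_on with
  | C a => simp [scale]
  | add p q hp hq => simp [hp, hq]
  | mul_X p j hp => simp [hp]; simp [scale]

lemma scale_potential {A : Matrix (Fin (n + 1)) (Fin (n + 1)) ℕ} {l : Fin (n + 1) → ℂˣ}
    (hl : l ∈ diagAut A) : scale l (potential A) = potential A :=
  MvPolynomial.funext fun x => (eval_scale l x _).trans (hl x)

lemma scale_isWeightedHomogeneous (l : Fin (n + 1) → ℂˣ) {q : Fin (n + 1) → ℕ} {k : ℕ}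
    {p : MvPolynomial (Fin (n + 1)) ℂ} (hp : IsWeightedHomogeneous q p k) :
    IsWeightedHomogeneous q (scale l p) k := by
  rw [← support_sum_monomial_coeff p, map_sum]
  refine IsWeightedHomogeneous.sum _ _ _ fun m hm => ?_
  rw [scale, aeval_monomial, ← hp (mem_support_iff.mp hm)]
  refine IsWeightedHomogeneous.C_mul ?_ _
  rw [Finsupp.weight_apply]
  refine IsWeightedHomogeneous.prod _ _ _ fun j _ => ?_
  exact ((isWeightedHomogeneous_X ℂ q j).C_mul _).pow (m j)

/-- The action of a diagonal automorphism on the coordinate ring, `x_j ↦ l_j x_j`. -/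
def coordAct (A : Matrix (Fin (n + 1)) (Fin (n + 1)) ℕ) (l : diagAut A) :
    CoordRing A →ₐ[ℂ] CoordRing A :=
  Ideal.quotientMapₐ _ (scale l.1) <| by
    rw [Ideal.span_singleton_le_iff_mem, Ideal.mem_comap]
    exact (scale_potential l.2).symm ▸ Ideal.mem_span_singleton_self _

lemma coordAct_toCoordRing (A : Matrix (Fin (n + 1)) (Fin (n + 1)) ℕ) (l : diagAut A)
    (p : MvPolynomial (Fin (n + 1)) ℂ) :
    coordAct A l (toCoordRing A p) = toCoordRing A (scale l.1 p) :=
  rfl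

lemma coordAct_mem (A : Matrix (Fin (n + 1)) (Fin (n + 1)) ℕ) (l : diagAut A)
    {q : Fin (n + 1) → ℕ} {k : ℕ} {s : CoordRing A} (hs : s ∈ coordGrading A q k) :
    coordAct A l s ∈ coordGrading A q k := by
  obtain ⟨p, hp, rfl⟩ := hs
  exact ⟨scale l.1 p, scale_isWeightedHomogeneous l.1 hp, rfl⟩

lemma coordProj_coordAct {A : Matrix (Fin (n + 1)) (Fin (n + 1)) ℕ} {q : Fin (n + 1) → ℕ}
    {d : ℕ} (h : IsWeightSystem A q d) (l : diagAut A) (k : ℕ) (s : CoordRing A) :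
    coordProj h k (coordAct A l s) = coordAct A l (coordProj h k s) := by
  obtain ⟨t, ht⟩ := exists_sum_coordProj h s
  rw [← ht]
  simp only [map_sum]
  refine Finset.sum_congr rfl fun j _ => ?_
  have hj := coordProj_mem h j s
  by_cases hkj : k = j
  · subst hkj
    rw [coordProj_same h k _ (coordAct_mem A l hj), coordProj_same h k _ hj]
  · rw [coordProj_ne h k j hkj _ (coordAct_mem A l hj), coordProj_ne h k j hkj _ hj, map_zero]

/-- The ring of `G`-invariants in the coordinate ring, for a group `G` of diagonal
automorphisms. -/
def invariants (A : Matrix (Fin (n + 1)) (Fin (n + 1)) ℕ) (G : Subgroup (Fin (n + 1) → ℂˣ))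
    (hG : G ≤ diagAut A) : Subalgebra ℂ (CoordRing A) :=
  ⨅ g : G, AlgHom.equalizer (coordAct A ⟨g.1, hG g.2⟩) (AlgHom.id ℂ (CoordRing A))

lemma mem_invariants {A : Matrix (Fin (n + 1)) (Fin (n + 1)) ℕ}
    {G : Subgroup (Fin (n + 1) → ℂˣ)} (hG : G ≤ diagAut A) {s : CoordRing A} :
    s ∈ invariants A G hG ↔ ∀ g (hg : g ∈ G), coordAct A ⟨g, hG hg⟩ s = s := by
  simp [invariants, Algebra.mem_iInf]

lemma coordProj_mem_invariants {A : Matrix (Fin (n + 1)) (Fin (n + 1)) ℕ}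
    {q : Fin (n + 1) → ℕ} {d : ℕ} (h : IsWeightSystem A q d)
    {G : Subgroup (Fin (n + 1) → ℂˣ)} (hG : G ≤ diagAut A) (k : ℕ) {s : CoordRing A}
    (hs : s ∈ invariants A G hG) : coordProj h k s ∈ invariants A G hG := by
  rw [mem_invariants] at hs ⊢
  intro g hg
  rw [← coordProj_coordAct, hs g hg]

/-- The induced grading of the ring of invariants. -/
def invariantGrading (A : Matrix (Fin (n + 1)) (Fin (n + 1)) ℕ) (q : Fin (n + 1) → ℕ)
    (G : Subgroup (Fin (n + 1) → ℂˣ)) (hG : G ≤ diagAut A) (k : ℕ) :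
    Submodule ℂ (invariants A G hG) :=
  (coordGrading A q k).comap (invariants A G hG).val.toLinearMap

/-- The coordinate ring is graded by the weights. -/
abbrev coordGradedAlgebra {A : Matrix (Fin (n + 1)) (Fin (n + 1)) ℕ} {q : Fin (n + 1) → ℕ} {d : ℕ}
    (h : IsWeightSystem A q d) : GradedAlgebra (coordGrading A q) :=
  gradedAlgebraOfProj _ (coordGrading_gradedMonoid A q) (coordProj h) (coordProj_same h)
    (coordProj_ne h) <| by
      refine eq_top_iff.mpr fun s _ => ?_
      obtain ⟨t, ht⟩ := exists_sum_coordProj h s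
      rw [← ht]
      exact sum_mem fun k _ => Submodule.mem_iSup_of_mem k (coordProj_mem h k s)

/-- The ring of invariants is graded by the weights. -/
abbrev invariantGradedAlgebra {A : Matrix (Fin (n + 1)) (Fin (n + 1)) ℕ} {q : Fin (n + 1) → ℕ}
    {d : ℕ} (h : IsWeightSystem A q d) (G : Subgroup (Fin (n + 1) → ℂˣ)) (hG : G ≤ diagAut A) :
    GradedAlgebra (invariantGrading A q G hG) :=
  gradedAlgebraOfProj _
    { one_mem := (coordGrading_gradedMonoid A q).one_mem
      mul_mem := fun _ _ _ _ hs ht => (coordGrading_gradedMonoid A q).mul_mem hs ht }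
    (fun k => (coordProj h k).restrict (p := Subalgebra.toSubmodule (invariants A G hG))
      (q := Subalgebra.toSubmodule (invariants A G hG))
      fun _ hs => coordProj_mem_invariants h hG k hs)
    (fun k s hs => Subtype.ext (coordProj_same h k s hs))
    (fun k l hkl s hs => Subtype.ext (coordProj_ne h k l hkl s hs)) <| by
      refine eq_top_iff.mpr fun s _ => ?_
      obtain ⟨t, ht⟩ := exists_sum_coordProj h s.1
      have : s = ∑ k ∈ t, (⟨coordProj h k s.1, coordProj_mem_invariants h hG k s.2⟩ :
          invariants A G hG) := Subtype.ext (by simpa using ht.symm)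
      rw [this]
      exact sum_mem fun k _ => Submodule.mem_iSup_of_mem k (coordProj_mem h k s.1)

/-- The hypersurface `X_A = Z(F_A)` in the weighted projective space with weights `q`. -/
def hypersurface {A : Matrix (Fin (n + 1)) (Fin (n + 1)) ℕ} {q : Fin (n + 1) → ℕ} {d : ℕ}
    (h : IsWeightSystem A q d) : Scheme :=
  letI := coordGradedAlgebra h
  Proj (coordGrading A q)

/-- The quotient `Z_{A,G} = X_A / G̃` of the projective scheme `X_A` by a group `G` of diagonal
automorphisms: the `Proj` of the `G`-invariants in the homogeneous coordinate ring of `X_A`.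
Locally this is the spectrum of the `G`-invariant functions on a `G`-stable affine open subset of
`X_A`. The subgroup `J_{F_A}` of `G` acts trivially on `X_A`, so that dividing by
`G̃ = G / J_{F_A}` is the same as dividing by `G`. -/
def orbifold {A : Matrix (Fin (n + 1)) (Fin (n + 1)) ℕ} {q : Fin (n + 1) → ℕ} {d : ℕ}
    (h : IsWeightSystem A q d) (G : Subgroup (Fin (n + 1) → ℂˣ)) (hG : G ≤ diagAut A) : Scheme :=
  letI := invariantGradedAlgebra h G hG
  Proj (invariantGrading A q G hG)

/-- The structure morphism `Z_{A,G} ⟶ Spec ℂ`. -/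
def orbifoldToSpec {A : Matrix (Fin (n + 1)) (Fin (n + 1)) ℕ} {q : Fin (n + 1) → ℕ} {d : ℕ}
    (h : IsWeightSystem A q d) (G : Subgroup (Fin (n + 1) → ℂˣ)) (hG : G ≤ diagAut A) :
    orbifold h G hG ⟶ Spec (.of ℂ) :=
  letI := invariantGradedAlgebra h G hG
  Proj.toSpecZero (invariantGrading A q G hG) ≫
    Spec.map (CommRingCat.ofHom (algebraMap ℂ (invariantGrading A q G hG 0)))

end

end BHK

/-! The substitution `x^m ↦ X^(A⁻¹ m)` turns `F_{A^T}` into `X_0 + … + X_n`, since its monomials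
have the columns of `A` as exponents and `A⁻¹` sends these to the standard basis. What remains of
`A` is only which rational exponents occur, so `A` and `A'` can be compared inside the single ring
`TorusHypersurface n`.

There, `x^m` is `G^T`-invariant exactly when `A⁻¹ m` lies in `dualLattice G`, a lattice defined from
`G` alone (`mem_dualLattice_iff`), and the weighted degree of `x^m` is `e` times the coordinate sum
of `A⁻¹ m` (`weight_eq`). Hence the invariant fractions of degree zero whose denominators are powers
of a suitable `∏ x_j ^ D` become the span of the `X^v` with `v ∈ dualLattice G` and `∑ v_i = 0`
(`fractions_eq_degreeZeroFunctions`). This span does not see `A`. The fractions form the coordinate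
ring of a dense affine open subset of the quotient, so equal spans give birational quotients
(`birationalOver_of_fractions_eq`).

The comparison needs the coordinate ring to embed in `TorusHypersurface n`
(`coordToTorus_injective`), which holds because no variable divides `F_{A^T}`. This fact and the
positive weights of `A^T` both follow from a fragment of the classification of invertible potentials
(`IsCalabiYauPotential.exists_isChainLoop`): each row is `x_j^a` or `x_j^a x_k` with `a ≥ 2`. -/

namespace BHK

noncomputable section

/-! ### Birational equivalence of projective spectra -/

section Proj

variable {R : Type} [CommRing R] [Algebra ℂ R] (𝓡 : ℕ → Submodule ℂ R) [GradedAlgebra 𝓡]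

/-- A nonempty `D₊(g)` contains a point outside which some homogeneous component `g'` of `g` lies.
As `f` is not a zero divisor, `f * g'` is not nilpotent, so `D₊(f * g')` is a nonempty subset of
`D₊(f) ∩ D₊(g)`. -/
lemma isDominant_awayι {f : R} {m : ℕ} (hf : f ∈ 𝓡 m) (hm : 0 < m)
    (hf' : f ∈ nonZeroDivisors R) : IsDominant (Proj.awayι 𝓡 f hf hm) := by
  refine ⟨?_⟩
  have hrange : Set.range (Proj.awayι 𝓡 f hf hm) = (Proj.basicOpen 𝓡 f : Set (Proj 𝓡)) :=
    congrArg (fun U : (Proj 𝓡).Opens => (U : Set (Proj 𝓡))) (Proj.opensRange_awayι 𝓡 f hf hm)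
  rw [DenseRange, hrange, (Proj.isBasis_basicOpen 𝓡).dense_iff]
  rintro _ ⟨_, ⟨g, rfl⟩, rfl⟩ ⟨x, hx⟩
  have hx' : x ∈ Proj.basicOpen 𝓡 g := hx
  rw [Proj.basicOpen_eq_iSup_proj, TopologicalSpace.Opens.mem_iSup] at hx'
  obtain ⟨i, hi⟩ := hx'
  set g' := GradedRing.proj 𝓡 i g with hg'
  have hg'i : g' ∈ 𝓡 i := SetLike.coe_mem _
  have hprime := x.isPrime
  have hnil : ¬ IsNilpotent (f * g') := by
    rintro ⟨k, hk⟩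
    rw [mul_pow] at hk
    have h0 : g' ^ k = 0 := by
      have := pow_mem hf' k
      exact (mul_right_mem_nonZeroDivisors_eq_zero_iff this).mp (by rwa [mul_comm] at hk)
    refine hi (hprime.mem_of_pow_mem k ?_)
    rw [h0]
    exact zero_mem _
  have hfg : f * g' ∈ 𝓡 (m + i) := SetLike.mul_mem_graded hf hg'i
  have hntl : Nontrivial (Localization.Away (f * g')) := by
    rw [← not_subsingleton_iff_nontrivial]
    intro hs
    rw [IsLocalization.subsingleton_iff (M := Submonoid.powers (f * g'))] at hs
    obtain ⟨k, hk⟩ := hs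
    exact hnil ⟨k, hk⟩
  have hntl' : Nontrivial (HomogeneousLocalization.Away 𝓡 (f * g')) := by
    refine ⟨0, 1, fun h => ?_⟩
    have := congrArg HomogeneousLocalization.val h
    simp at this
  obtain ⟨p⟩ : Nonempty (PrimeSpectrum (HomogeneousLocalization.Away 𝓡 (f * g'))) := inferInstance
  let y := Proj.awayι 𝓡 (f * g') hfg (by omega) p
  have hy : y ∈ Proj.basicOpen 𝓡 (f * g') := by
    rw [← Proj.opensRange_awayι 𝓡 (f * g') hfg (by omega)]
    exact ⟨p, rfl⟩
  rw [Proj.basicOpen_mul] at hy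
  refine ⟨y, ?_, hy.1⟩
  have : y ∈ Proj.basicOpen 𝓡 g := by
    rw [Proj.basicOpen_eq_iSup_proj, TopologicalSpace.Opens.mem_iSup]
    exact ⟨i, hy.2⟩
  exact this

/-- The structure morphism `Proj 𝓡 ⟶ Spec ℂ` of a graded `ℂ`-algebra. -/
abbrev projToSpec : Proj 𝓡 ⟶ Spec (.of ℂ) :=
  Proj.toSpecZero 𝓡 ≫ Spec.map (CommRingCat.ofHom (algebraMap ℂ (𝓡 0)))

/-- The `ℂ`-algebra structure of the degree zero part of the localization at `f`. -/
abbrev awayScalars (f : R) : ℂ →+* HomogeneousLocalization.Away 𝓡 f :=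
  (HomogeneousLocalization.fromZeroRingHom 𝓡 _).comp (algebraMap ℂ (𝓡 0))

lemma birationalOver_specAway {f : R} {m : ℕ} (hf : f ∈ 𝓡 m) (hm : 0 < m)
    (hf' : f ∈ nonZeroDivisors R) :
    Scheme.BirationalOver (Spec.map (CommRingCat.ofHom (awayScalars 𝓡 f))) (projToSpec 𝓡) := by
  have := isDominant_awayι 𝓡 hf hm hf'
  refine (Proj.awayι 𝓡 f hf hm).birationalOver _ _ ?_
  rw [projToSpec, Proj.awayι_toSpecZero_assoc, ← Spec.map_comp]
  rfl

/-! ### Degree-zero fractions inside a common ring -/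

variable {𝓡} {Q : Type} [CommRing Q] [Algebra ℂ Q]

/-- The extension to the localization at `f` of a homomorphism for which `f` becomes a unit. -/
def localizationHom (χ : R →ₐ[ℂ] Q) {f : R} (hu : IsUnit (χ f)) : Localization.Away f →+* Q :=
  IsLocalization.Away.lift (S := Localization.Away f) f (g := χ.toRingHom) hu

lemma localizationHom_algebraMap (χ : R →ₐ[ℂ] Q) {f : R} (hu : IsUnit (χ f)) (a : R) :
    localizationHom χ hu (algebraMap R (Localization.Away f) a) = χ a :=
  IsLocalization.Away.lift_eq (S := Localization.Away f) f (g := χ.toRingHom) hu a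

/-- The homomorphism to `Q` from the degree zero part of the localization at an element `f` whose
image in `Q` is a unit. -/
def awayHom (χ : R →ₐ[ℂ] Q) {f : R} (hu : IsUnit (χ f)) :
    HomogeneousLocalization.Away 𝓡 f →+* Q :=
  (localizationHom χ hu).comp
    (algebraMap (HomogeneousLocalization.Away 𝓡 f) (Localization.Away f))

lemma awayHom_mk (χ : R →ₐ[ℂ] Q) {f : R} (hu : IsUnit (χ f)) {m : ℕ} (hf : f ∈ 𝓡 m) (k : ℕ)
    (a : R) (ha : a ∈ 𝓡 (k • m)) :
    awayHom χ hu (HomogeneousLocalization.Away.mk 𝓡 hf k a ha) * χ f ^ k = χ a := by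
  rw [awayHom, RingHom.comp_apply, HomogeneousLocalization.algebraMap_apply,
    HomogeneousLocalization.Away.val_mk, ← map_pow, ← localizationHom_algebraMap χ hu (f ^ k),
    ← map_mul, ← localizationHom_algebraMap χ hu a, Localization.mk_eq_mk']
  exact congrArg _ (IsLocalization.mk'_spec _ a ⟨f ^ k, _⟩)

lemma awayHom_injective {χ : R →ₐ[ℂ] Q} (hχ : Function.Injective χ) {f : R}
    (hu : IsUnit (χ f)) {m : ℕ} (hf : f ∈ 𝓡 m) :
    Function.Injective (awayHom (𝓡 := 𝓡) χ hu) := by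
  rw [injective_iff_map_eq_zero]
  intro w hw
  obtain ⟨k, a, ha, rfl⟩ := HomogeneousLocalization.Away.mk_surjective 𝓡 hf w
  have h := awayHom_mk χ hu hf k a ha
  rw [hw, zero_mul] at h
  have h0 : a = 0 := hχ (h.symm.trans (map_zero χ).symm)
  exact HomogeneousLocalization.mk_eq_zero_of_num _ (Subtype.ext h0)

lemma awayHom_comp_awayScalars (χ : R →ₐ[ℂ] Q) {f : R} (hu : IsUnit (χ f)) :
    (awayHom (𝓡 := 𝓡) χ hu).comp (awayScalars 𝓡 f) = algebraMap ℂ Q := by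
  ext c
  have h : (awayScalars 𝓡 f c).val = algebraMap R (Localization.Away f) (algebraMap ℂ R c) :=
    Localization.mk_one_eq_algebraMap _
  rw [RingHom.comp_apply, awayHom, RingHom.comp_apply, HomogeneousLocalization.algebraMap_apply, h,
    localizationHom_algebraMap, AlgHom.commutes]

/-- The fractions of degree zero with denominator a power of `f`, in a ring `Q`. -/
def fractions (𝓡 : ℕ → Submodule ℂ R) [GradedAlgebra 𝓡] (χ : R →ₐ[ℂ] Q) {f : R} {m : ℕ}
    (hf : f ∈ 𝓡 m) : Submodule ℂ Q where
  carrier := {y | ∃ k, ∃ a ∈ 𝓡 (k • m), χ a = y * χ f ^ k}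
  zero_mem' := ⟨0, 0, zero_mem _, by simp⟩
  add_mem' := by
    rintro y z ⟨k, a, ha, hay⟩ ⟨l, b, hb, hbz⟩
    refine ⟨k + l, a * f ^ l + f ^ k * b, ?_, ?_⟩
    · rw [add_smul]
      exact add_mem (SetLike.mul_mem_graded ha (SetLike.pow_mem_graded l hf))
        (SetLike.mul_mem_graded (SetLike.pow_mem_graded k hf) hb)
    · simp only [map_add, map_mul, map_pow, hay, hbz]
      ring
  smul_mem' := by
    rintro c y ⟨k, a, ha, hay⟩
    exact ⟨k, c • a, Submodule.smul_mem _ c ha, by simp [hay]⟩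

lemma range_awayHom (χ : R →ₐ[ℂ] Q) {f : R} (hu : IsUnit (χ f)) {m : ℕ} (hf : f ∈ 𝓡 m) :
    Set.range (awayHom (𝓡 := 𝓡) χ hu) = fractions 𝓡 χ hf := by
  ext y
  constructor
  · rintro ⟨w, rfl⟩
    obtain ⟨k, a, ha, rfl⟩ := HomogeneousLocalization.Away.mk_surjective 𝓡 hf w
    exact ⟨k, a, ha, (awayHom_mk χ hu hf k a ha).symm⟩
  · rintro ⟨k, a, ha, h⟩
    refine ⟨HomogeneousLocalization.Away.mk 𝓡 hf k a ha, ?_⟩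
    rw [← awayHom_mk χ hu hf k a ha] at h
    exact (hu.pow k).mul_right_cancel h

end Proj

/-- Two injections with the same image identify their sources, compatibly with the scalars, so the
two spectra are even isomorphic over `k`. -/
lemma birationalOver_of_range_eq {k W W' Q : Type} [CommRing k] [CommRing W] [CommRing W']
    [CommRing Q] (c : k →+* W) (c' : k →+* W') (ψ : W →+* Q) (ψ' : W' →+* Q)
    (hψ : Function.Injective ψ) (hψ' : Function.Injective ψ') (hc : ψ.comp c = ψ'.comp c')
    (hrange : Set.range ψ = Set.range ψ') :
    Scheme.BirationalOver (Spec.map (CommRingCat.ofHom c)) (Spec.map (CommRingCat.ofHom c')) := by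
  have hr : ψ.range = ψ'.range := SetLike.coe_injective hrange
  let e : W ≃+* W' := (RingEquiv.ofBijective ψ.rangeRestrict
    ⟨fun a b h => hψ (congrArg Subtype.val h), ψ.rangeRestrict_surjective⟩).trans
    ((RingEquiv.subringCongr hr).trans (RingEquiv.ofBijective ψ'.rangeRestrict
    ⟨fun a b h => hψ' (congrArg Subtype.val h), ψ'.rangeRestrict_surjective⟩).symm)
  have he : ∀ w, ψ' (e w) = ψ w := by
    intro w
    have : ψ'.rangeRestrict (e w) = RingEquiv.subringCongr hr (ψ.rangeRestrict w) :=
      (RingEquiv.ofBijective ψ'.rangeRestrict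
        ⟨fun a b h => hψ' (congrArg Subtype.val h), ψ'.rangeRestrict_surjective⟩).apply_symm_apply _
    exact congrArg Subtype.val this
  have hec : (e : W →+* W').comp c = c' := by
    ext x
    apply hψ'
    exact (he _).trans (RingHom.congr_fun hc x)
  let i : Spec (.of W') ≅ Spec (.of W) := Scheme.Spec.mapIso e.toCommRingCatIso.op
  refine (Scheme.Hom.birationalOver i.hom _ _ ?_).symm
  change Spec.map _ ≫ Spec.map _ = _
  rw [← Spec.map_comp, ← hec]
  rfl

/-- Each `Proj` contains the spectrum of its degree-zero fractions as a dense open subset, and these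
rings have the same image in `Q`. Density holds because `f` becomes a unit under an injective map,
hence is not a zero divisor. -/
theorem birationalOver_of_fractions_eq {R R' Q : Type} [CommRing R] [Algebra ℂ R] [CommRing R']
    [Algebra ℂ R'] [CommRing Q] [Algebra ℂ Q] (𝓡 : ℕ → Submodule ℂ R) [GradedAlgebra 𝓡]
    (𝓡' : ℕ → Submodule ℂ R') [GradedAlgebra 𝓡'] {χ : R →ₐ[ℂ] Q} {χ' : R' →ₐ[ℂ] Q}
    (hχ : Function.Injective χ) (hχ' : Function.Injective χ') {f : R} {f' : R'}
    (hu : IsUnit (χ f)) (hu' : IsUnit (χ' f')) {m m' : ℕ} (hf : f ∈ 𝓡 m) (hf' : f' ∈ 𝓡' m')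
    (hm : 0 < m) (hm' : 0 < m') (h : fractions 𝓡 χ hf = fractions 𝓡' χ' hf') :
    Scheme.BirationalOver (projToSpec 𝓡) (projToSpec 𝓡') := by
  refine (birationalOver_specAway 𝓡 hf hm ?_).symm.trans
    (.trans ?_ (birationalOver_specAway 𝓡' hf' hm' ?_))
  · exact mem_nonZeroDivisors_of_injective hχ hu.mem_nonZeroDivisors
  · refine birationalOver_of_range_eq _ _ (awayHom χ hu) (awayHom χ' hu')
      (awayHom_injective hχ hu hf) (awayHom_injective hχ' hu' hf') ?_ ?_
    · rw [awayHom_comp_awayScalars, awayHom_comp_awayScalars]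
    · rw [range_awayHom χ hu hf, range_awayHom χ' hu' hf', h]
  · exact mem_nonZeroDivisors_of_injective hχ' hu'.mem_nonZeroDivisors

variable {n : ℕ}

/-! ### The weights of the transposed potential -/

lemma prod_X_pow_eq_monomial (a : Fin (n + 1) → ℕ) :
    ∏ j, (X j : MvPolynomial (Fin (n + 1)) ℂ) ^ a j
      = monomial (Finsupp.equivFunOnFinite.symm a) 1 := by
  rw [monomial_eq, Finsupp.prod_fintype _ _ (by simp)]
  simp

lemma eval_potential (A : Matrix (Fin (n + 1)) (Fin (n + 1)) ℕ) (x : Fin (n + 1) → ℂ) :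
    eval x (potential A) = ∑ i, ∏ j, x j ^ A i j := by
  simp [potential]

lemma eval_pderiv_potential (A : Matrix (Fin (n + 1)) (Fin (n + 1)) ℕ) (x : Fin (n + 1) → ℂ)
    (k : Fin (n + 1)) :
    eval x (pderiv k (potential A))
      = ∑ i, (A i k : ℂ) * ∏ l, x l ^ (A i l - if l = k then 1 else 0) := by
  simp only [potential, map_sum, prod_X_pow_eq_monomial, pderiv_monomial, eval_monomial]
  refine Finset.sum_congr rfl fun i _ => ?_
  rw [Finsupp.prod_fintype _ _ (by simp)]
  simp [Finsupp.single_apply, eq_comm]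

/-- Each row of `A` is, after reordering, a power `x_j ^ a` with `a ≥ 2`, possibly multiplied by
one further variable, and no variable occurs twice as such a further variable. -/
structure IsChainLoop (A : Matrix (Fin (n + 1)) (Fin (n + 1)) ℕ)
    (σ : Fin (n + 1) → Fin (n + 1)) (t : Fin (n + 1) → Option (Fin (n + 1))) : Prop where
  bijective : Function.Bijective σ
  two_le : ∀ j, 2 ≤ A (σ j) j
  tail_ne : ∀ j, t j ≠ some j
  entry : ∀ j l, l ≠ j → A (σ j) l = if t j = some l then 1 else 0
  tail_inj : ∀ j j' k, t j = some k → t j' = some k → j = j'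

/-- The `j`-th coordinate point is not singular, so `F_A` or one of its first derivatives is nonzero
there; this forces a monomial `x_j^a` or `x_j^a x_k`. The Calabi-Yau condition then excludes `a ≤
1`. -/
lemma IsCalabiYauPotential.exists_row {A : Matrix (Fin (n + 1)) (Fin (n + 1)) ℕ}
    {q : Fin (n + 1) → ℕ} {d : ℕ} (hn : 2 ≤ n) (h : IsCalabiYauPotential A q d)
    (j : Fin (n + 1)) :
    ∃ (i : Fin (n + 1)) (t : Option (Fin (n + 1))), 2 ≤ A i j ∧ t ≠ some j ∧
      ∀ l, l ≠ j → A i l = if t = some l then 1 else 0 := by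
  classical
  have key : ∃ (i : Fin (n + 1)) (t : Option (Fin (n + 1))), t ≠ some j ∧
      ∀ l, l ≠ j → A i l = if t = some l then 1 else 0 := by
    have hx : (Pi.single j 1 : Fin (n + 1) → ℂ) ∉ affineSingularLocus (potential A) := by
      rw [h.nondegenerate]
      simp
    rw [affineSingularLocus, Set.mem_ofPred_eq, not_and_or] at hx
    rcases hx with hx | hx
    · rw [eval_potential] at hx
      obtain ⟨i, -, hi⟩ := Finset.exists_ne_zero_of_sum_ne_zero hx
      refine ⟨i, none, by simp, fun l hl => ?_⟩
      have := Finset.prod_ne_zero_iff.mp hi l (Finset.mem_univ l)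
      simpa [hl] using this
    · push Not at hx
      obtain ⟨k, hk⟩ := hx
      rw [eval_pderiv_potential] at hk
      obtain ⟨i, -, hi⟩ := Finset.exists_ne_zero_of_sum_ne_zero hk
      have hik : A i k ≠ 0 := by
        rintro h0
        simp [h0] at hi
      have hi' := Finset.prod_ne_zero_iff.mp (right_ne_zero_of_mul hi)
      have hl : ∀ l, l ≠ j → A i l - (if l = k then 1 else 0) = 0 := by
        intro l hl
        have := hi' l (Finset.mem_univ l)
        rw [Pi.single_eq_of_ne hl] at this
        by_contra h0
        exact this (zero_pow h0)
      by_cases hkj : k = j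
      · subst hkj
        refine ⟨i, none, by simp, fun l hlk => ?_⟩
        have := hl l hlk
        simpa [hlk] using this
      · refine ⟨i, some k, by simpa using hkj, fun l hlj => ?_⟩
        have := hl l hlj
        by_cases hlk : l = k
        · subst hlk
          simp at this ⊢
          omega
        · have hkl : k ≠ l := fun h => hlk h.symm
          simpa [hlk, hkl] using this
  obtain ⟨i, t, ht, hl⟩ := key
  refine ⟨i, t, ?_, ht, hl⟩
  -- With `a ≤ 1` the row is squarefree and involves at most two of the at least three variables, so
  -- its degree is strictly below `∑ q_l = d`.
  by_contra hlt
  obtain ⟨k, hk⟩ : ∃ k, ∀ l, l ≠ j → l ≠ k → A i l = 0 := by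
    rcases t with _ | k
    · exact ⟨j, fun l hlj _ => by simpa using hl l hlj⟩
    · refine ⟨k, fun l hlj hlk => ?_⟩
      have hkl : k ≠ l := fun h => hlk h.symm
      simpa [hkl] using hl l hlj
  have hle1 : ∀ l, A i l ≤ 1 := by
    intro l
    by_cases hlj : l = j
    · subst hlj
      omega
    · rw [hl l hlj]
      split_ifs <;> simp
  obtain ⟨m, hm⟩ : ∃ m, m ∉ ({j, k} : Finset (Fin (n + 1))) := by
    by_contra! hall
    have h1 : (Finset.univ : Finset (Fin (n + 1))).card ≤ ({j, k} : Finset (Fin (n + 1))).card :=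
      Finset.card_le_card fun l _ => hall l
    have h2 : ({j, k} : Finset (Fin (n + 1))).card ≤ 2 := Finset.card_le_two
    simp at h1
    omega
  simp only [Finset.mem_insert, Finset.mem_singleton, not_or] at hm
  have hlt' : ∑ l, A i l * q l < ∑ l, q l := by
    refine Finset.sum_lt_sum (fun l _ => ?_) ⟨m, Finset.mem_univ m, ?_⟩
    · exact (Nat.mul_le_mul_right _ (hle1 l)).trans_eq (one_mul _)
    · rw [hk m hm.1 hm.2, zero_mul]
      exact h.isWeightSystem.weight_pos m
  rw [h.isWeightSystem.sum_eq i, h.calabiYau] at hlt'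
  exact lt_irrefl _ hlt'

/-- Rows for different `j` differ because a row has at most one exponent `≥ 2`. If two rows `x_j^a
x_k` and `x_j'^b x_k` shared a tail, the hypersurface would be singular where `x_j^a + x_j'^b = 0`
and all other coordinates vanish. -/
lemma IsCalabiYauPotential.exists_isChainLoop {A : Matrix (Fin (n + 1)) (Fin (n + 1)) ℕ}
    {q : Fin (n + 1) → ℕ} {d : ℕ} (hn : 2 ≤ n) (h : IsCalabiYauPotential A q d) :
    ∃ σ t, IsChainLoop A σ t := by
  classical
  choose σ t h2 ht hl using h.exists_row hn
  have hle : ∀ j l, l ≠ j → A (σ j) l ≤ 1 := fun j l hlj => by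
    rw [hl j l hlj]
    split_ifs <;> simp
  have hinj : Function.Injective σ := by
    intro j j' hjj'
    by_contra hne
    have h1 := hle j j' (Ne.symm hne)
    have h2' := h2 j'
    rw [hjj'] at h1
    omega
  have hbij := Finite.injective_iff_bijective.mp hinj
  refine ⟨σ, t, hbij, h2, ht, hl, ?_⟩
  intro j j' k hj hj'
  by_contra hne
  have hkj : k ≠ j := fun hk => ht j (hk ▸ hj)
  have hkj' : k ≠ j' := fun hk => ht j' (hk ▸ hj')
  -- The singular point has `x_j = s` and `x_j' = 1`. Every monomial vanishes there, and the only
  -- derivative with nonzero terms is the one in `x_k`, equal to `s^a + 1 = 0`.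
  obtain ⟨s, hs⟩ := IsAlgClosed.exists_pow_nat_eq (-1 : ℂ) (n := A (σ j) j)
    (by have := h2 j; omega)
  let x : Fin (n + 1) → ℂ := Function.update (Pi.single j' 1) j s
  have hxj : x j = s := by simp [x]
  have hxj' : x j' = 1 := by simp [x, Ne.symm hne]
  have hx0 : ∀ l, l ≠ j → l ≠ j' → x l = 0 := fun l h1 h2 => by simp [x, h1, h2]
  have hxk : x k = 0 := hx0 k hkj hkj'
  suffices hmem : x ∈ affineSingularLocus (potential A) by
    rw [h.nondegenerate, Set.mem_singleton_iff] at hmem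
    have := congrFun hmem j'
    rw [hxj'] at this
    simp at this
  have hrow : ∀ i, ∃ l, A (σ i) l ≠ 0 ∧ x l = 0 ∧
      (i ≠ j → i ≠ j' → l = i) ∧ (i = j ∨ i = j' → l = k) := by
    intro i
    by_cases hij : i = j
    · refine ⟨k, ?_, hxk, fun h1 => absurd hij h1, fun _ => rfl⟩
      rw [hij, hl j k hkj]
      simp [hj]
    · by_cases hij' : i = j'
      · refine ⟨k, ?_, hxk, fun _ h1 => absurd hij' h1, fun _ => rfl⟩
        rw [hij', hl j' k hkj']
        simp [hj']
      · exact ⟨i, by have := h2 i; omega, hx0 i hij hij', fun _ _ => rfl,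
          fun h => (h.elim hij hij').elim⟩
  constructor
  · rw [eval_potential]
    refine Finset.sum_eq_zero fun i _ => ?_
    obtain ⟨i, rfl⟩ := hbij.2 i
    obtain ⟨l, hl1, hl2, -⟩ := hrow i
    exact Finset.prod_eq_zero (Finset.mem_univ l) (by rw [hl2, zero_pow hl1])
  · intro m
    rw [eval_pderiv_potential, ← Function.Bijective.sum_comp hbij
      (fun i => (A i m : ℂ) * ∏ l, x l ^ (A i l - if l = m then 1 else 0))]
    have hother : ∀ i, i ≠ j → i ≠ j' →
        (A (σ i) m : ℂ) * ∏ l, x l ^ (A (σ i) l - if l = m then 1 else 0) = 0 := by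
      intro i hij hij'
      refine mul_eq_zero_of_right _ (Finset.prod_eq_zero (Finset.mem_univ i) ?_)
      rw [hx0 i hij hij']
      refine zero_pow ?_
      have := h2 i
      split_ifs <;> omega
    have hmain : ∀ i, t i = some k → k ≠ i → x k = 0 → (∀ l, l ≠ i → l ≠ k → A (σ i) l = 0) →
        (A (σ i) m : ℂ) * ∏ l, x l ^ (A (σ i) l - if l = m then 1 else 0)
          = if m = k then x i ^ A (σ i) i else 0 := by
      intro i hi hki hxk hzero
      have hk1 : A (σ i) k = 1 := by rw [hl i k hki, if_pos hi]
      by_cases hmk : m = k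
      · subst hmk
        rw [if_pos rfl, hk1, Nat.cast_one, one_mul, Finset.prod_eq_single i]
        · rw [if_neg (Ne.symm hki), Nat.sub_zero]
        · intro l _ hli
          by_cases hlm : l = m
          · rw [hlm, hk1, if_pos rfl, Nat.sub_self, pow_zero]
          · rw [hzero l hli hlm, Nat.zero_sub, pow_zero]
        · simp
      · rw [if_neg hmk]
        refine mul_eq_zero_of_right _ (Finset.prod_eq_zero (Finset.mem_univ k) ?_)
        rw [hxk, hk1, if_neg (Ne.symm hmk)]
        simp
    have hzero : ∀ i, t i = some k → ∀ l, l ≠ i → l ≠ k → A (σ i) l = 0 := by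
      intro i hi l hli hlk
      rw [hl i l hli, hi, if_neg]
      simpa using Ne.symm hlk
    rw [← Finset.sum_subset (Finset.subset_univ {j, j'}), Finset.sum_pair hne,
      hmain j hj hkj hxk (hzero j hj), hmain j' hj' hkj' hxk (hzero j' hj'), hxj, hxj', hs]
    · split_ifs <;> simp
    · intro i _ hi
      simp only [Finset.mem_insert, Finset.mem_singleton, not_or] at hi
      exact hother i hi.1 hi.2

lemma exists_pos_mul_int {ι : Type*} [Finite ι] (u : ι → ℚ) :
    ∃ D : ℕ, 0 < D ∧ ∀ i, ∃ z : ℤ, (D : ℚ) * u i = z := by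
  classical
  have := Fintype.ofFinite ι
  refine ⟨∏ i, (u i).den, Finset.prod_pos fun i _ => (u i).den_pos, fun i => ?_⟩
  refine ⟨(∏ j ∈ Finset.univ.erase i, (u j).den : ℕ) * (u i).num, ?_⟩
  rw [← Finset.mul_prod_erase _ _ (Finset.mem_univ i)]
  push_cast
  have := Rat.den_mul_eq_num (u i)
  rw [← this]
  ring

/-- The rational solution `v` of `v A = (1, …, 1)` is unique; it is positive because each of its
equations has the form `a v_i = 1` or `a v_i + v_j = 1` with `a ≥ 2`. Clearing denominators by `D`
gives weights of degree `D`. -/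
lemma IsChainLoop.exists_isWeightSystem_transpose {A : Matrix (Fin (n + 1)) (Fin (n + 1)) ℕ}
    (hA : (ratMatrix A).det ≠ 0) {σ : Fin (n + 1) → Fin (n + 1)}
    {t : Fin (n + 1) → Option (Fin (n + 1))} (h : IsChainLoop A σ t) :
    ∃ r e, IsWeightSystem A.transpose r e := by
  classical
  set v : Fin (n + 1) → ℚ := Matrix.vecMul 1 (ratMatrix A)⁻¹ with hv
  have hvA : ∀ i, ∑ j, v j * A j i = 1 := by
    intro i
    have : Matrix.vecMul v (ratMatrix A) = 1 := by
      rw [hv, Matrix.vecMul_vecMul, Matrix.nonsing_inv_mul _ (isUnit_iff_ne_zero.mpr hA),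
        Matrix.vecMul_one]
    simpa [Matrix.vecMul, dotProduct] using congrFun this i
  have hcol : ∀ i, (A (σ i) i : ℚ) * v (σ i) = 1 ∨
      ∃ j, (A (σ i) i : ℚ) * v (σ i) + v (σ j) = 1 := by
    intro i
    have hi := hvA i
    rw [← Function.Bijective.sum_comp h.bijective (fun j => v j * A j i),
      ← Finset.add_sum_erase _ _ (Finset.mem_univ i)] at hi
    by_cases hex : ∃ j, t j = some i
    · obtain ⟨j, hj⟩ := hex
      right
      refine ⟨j, ?_⟩
      have hji : j ≠ i := fun hji => h.tail_ne j (hji ▸ hj)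
      rw [Finset.sum_eq_single_of_mem j (by simpa using hji), h.entry j i hji.symm, if_pos hj,
        Nat.cast_one, mul_one] at hi
      · linarith
      · intro l hl hlj
        rw [h.entry l i (Finset.ne_of_mem_erase hl).symm, if_neg, Nat.cast_zero, mul_zero]
        exact fun hl' => hlj (h.tail_inj l j i hl' hj)
    · left
      rw [Finset.sum_eq_zero] at hi
      · linarith
      · intro l hl
        rw [h.entry l i (Finset.ne_of_mem_erase hl).symm, if_neg, Nat.cast_zero, mul_zero]
        exact fun hl' => hex ⟨l, hl'⟩
  have hpos : ∀ i, 0 < v (σ i) := by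
    obtain ⟨i, hi⟩ := Finite.exists_min fun i => v (σ i)
    suffices h0 : 0 < v (σ i) from fun j => h0.trans_le (hi j)
    -- If the minimum `v_i` were `≤ 0`, its equation would give `v_j ≥ 1 - 2 v_i ≥ 1`; the equation
    -- of `v_j` would then need some `v_k ≤ 1 - 2 v_j ≤ 4 v_i - 1 < v_i`.
    by_contra! hle
    have h2 : ∀ j, (2 : ℚ) ≤ A (σ j) j := fun j => by exact_mod_cast h.two_le j
    rcases hcol i with h1 | ⟨j, h1⟩
    · nlinarith [h2 i]
    · have hj : 1 - 2 * v (σ i) ≤ v (σ j) := by nlinarith [h2 i]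
      rcases hcol j with h3 | ⟨k, h3⟩
      · nlinarith [h2 j]
      · have : v (σ k) ≤ 1 - 2 * v (σ j) := by nlinarith [h2 j]
        linarith [hi k]
  have hpos' : ∀ i, 0 < v i := fun i => by
    obtain ⟨i, rfl⟩ := h.bijective.2 i
    exact hpos i
  obtain ⟨D, hD, hz⟩ := exists_pos_mul_int v
  choose z hz using hz
  have hzpos : ∀ i, 0 < z i := fun i => by
    have : (0 : ℚ) < z i := by
      rw [← hz i]
      exact mul_pos (by exact_mod_cast hD) (hpos' i)
    exact_mod_cast this
  have hzn : ∀ i, ((z i).toNat : ℚ) = D * v i := fun i => by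
    rw [hz i]
    exact_mod_cast congrArg (Int.cast : ℤ → ℚ) (Int.toNat_of_nonneg (hzpos i).le)
  refine ⟨fun i => (z i).toNat, D, fun i => ?_, hD, fun i => ?_⟩
  · have := hzpos i
    omega
  · have : ((∑ j, A.transpose i j * (z j).toNat : ℕ) : ℚ) = D := by
      push_cast
      simp only [hzn]
      calc _ = D * ∑ j, v j * A j i := by
            rw [Finset.mul_sum]
            exact Finset.sum_congr rfl fun j _ => by rw [Matrix.transpose_apply]; ring
        _ = D := by rw [hvA i, mul_one]
    exact_mod_cast this

/-- No variable divides all the monomials of the transposed potential. -/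
lemma IsChainLoop.exists_entry_eq_zero {A : Matrix (Fin (n + 1)) (Fin (n + 1)) ℕ} (hn : 2 ≤ n)
    {σ : Fin (n + 1) → Fin (n + 1)} {t : Fin (n + 1) → Option (Fin (n + 1))}
    (h : IsChainLoop A σ t) (i : Fin (n + 1)) : ∃ l, A i l = 0 := by
  classical
  obtain ⟨j, rfl⟩ := h.bijective.2 i
  -- The row involves at most `x_j` and its tail, while there are at least three variables; the
  -- default `j` covers rows without a tail.
  obtain ⟨m, hm⟩ : ∃ m, m ∉ ({j, (t j).getD j} : Finset (Fin (n + 1))) := by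
    by_contra! hall
    have h1 := Finset.card_le_card fun l (_ : l ∈ Finset.univ) => hall l
    have h2 : ({j, (t j).getD j} : Finset (Fin (n + 1))).card ≤ 2 := Finset.card_le_two
    simp at h1
    omega
  simp only [Finset.mem_insert, Finset.mem_singleton, not_or] at hm
  refine ⟨m, ?_⟩
  rw [h.entry j m hm.1, if_neg]
  intro htm
  simp [htm] at hm

/-! ### Comparison with a hyperplane section of a torus -/

/-- The group algebra of `ℚ^(n+1)`: Laurent polynomials with rational exponents. -/
abbrev TorusRing (n : ℕ) : Type := AddMonoidAlgebra ℂ (Fin (n + 1) → ℚ)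

/-- The sum of the coordinates on the torus. -/
def coordSum (n : ℕ) : TorusRing n := ∑ i, AddMonoidAlgebra.single (Pi.single i 1) 1

/-- The coordinate ring of the hypersurface on which the sum of the coordinates vanishes. -/
abbrev TorusHypersurface (n : ℕ) : Type := TorusRing n ⧸ Ideal.span {coordSum n}

/-- The function on the hypersurface defined by a monomial with exponent `v`. -/
def torusMonomial (v : Fin (n + 1) → ℚ) : TorusHypersurface n :=
  Ideal.Quotient.mkₐ ℂ _ (AddMonoidAlgebra.single v 1)

lemma torusMonomial_add (v w : Fin (n + 1) → ℚ) :
    torusMonomial (v + w) = torusMonomial v * torusMonomial w := by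
  rw [torusMonomial, torusMonomial, torusMonomial, ← map_mul, AddMonoidAlgebra.single_mul_single,
    one_mul]

lemma torusMonomial_zero : torusMonomial (0 : Fin (n + 1) → ℚ) = 1 :=
  map_one (Ideal.Quotient.mkₐ ℂ (Ideal.span {coordSum n}))

lemma torusMonomial_nsmul (k : ℕ) (v : Fin (n + 1) → ℚ) :
    torusMonomial (k • v) = torusMonomial v ^ k := by
  induction k with
  | zero => simp [torusMonomial_zero]
  | succ k ih => rw [succ_nsmul, torusMonomial_add, ih, pow_succ]

lemma isUnit_torusMonomial (v : Fin (n + 1) → ℚ) : IsUnit (torusMonomial v) :=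
  IsUnit.of_mul_eq_one (torusMonomial (-v)) <| by
    rw [← torusMonomial_add, add_neg_cancel, torusMonomial_zero]

/-- The exponent vector `A⁻¹ m`. -/
def expo (A : Matrix (Fin (n + 1)) (Fin (n + 1)) ℕ) :
    (Fin (n + 1) →₀ ℕ) →+ (Fin (n + 1) → ℚ) where
  toFun m := (ratMatrix A)⁻¹.mulVec fun j => (m j : ℚ)
  map_zero' := by
    ext
    simp [Matrix.mulVec, dotProduct]
  map_add' a b := by
    rw [← Matrix.mulVec_add]
    congr 1
    ext j
    simp

variable {A : Matrix (Fin (n + 1)) (Fin (n + 1)) ℕ}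

lemma mulVec_expo (hA : (ratMatrix A).det ≠ 0) (m : Fin (n + 1) →₀ ℕ) :
    (ratMatrix A).mulVec (expo A m) = fun j => (m j : ℚ) := by
  change (ratMatrix A).mulVec ((ratMatrix A)⁻¹.mulVec _) = _
  rw [Matrix.mulVec_mulVec, Matrix.mul_nonsing_inv _ (isUnit_iff_ne_zero.mpr hA),
    Matrix.one_mulVec]

lemma mulVec_injective (hA : (ratMatrix A).det ≠ 0) :
    Function.Injective (ratMatrix A).mulVec :=
  Matrix.mulVec_injective_of_isUnit
    ((Matrix.isUnit_iff_isUnit_det _).mpr (isUnit_iff_ne_zero.mpr hA))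

lemma expo_injective (hA : (ratMatrix A).det ≠ 0) : Function.Injective (expo A) := by
  intro a b hab
  have h := (mulVec_expo hA a).symm.trans ((congrArg _ hab).trans (mulVec_expo hA b))
  ext j
  exact_mod_cast congrFun h j

lemma expo_col (hA : (ratMatrix A).det ≠ 0) (i : Fin (n + 1)) :
    expo A (Finsupp.equivFunOnFinite.symm (A.transpose i)) = Pi.single i 1 := by
  apply mulVec_injective hA
  rw [mulVec_expo hA, Matrix.mulVec_single_one]
  ext j
  simp

variable (A) in
/-- The embedding of the polynomial ring in the ring of the torus, `x^m ↦ X^(A⁻¹ m)`. -/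
def toTorus : MvPolynomial (Fin (n + 1)) ℂ →ₐ[ℂ] TorusRing n :=
  AddMonoidAlgebra.mapDomainAlgHom ℂ ℂ (expo A)

lemma toTorus_monomial (m : Fin (n + 1) →₀ ℕ) (c : ℂ) :
    toTorus A (monomial m c) = AddMonoidAlgebra.single (expo A m) c :=
  AddMonoidAlgebra.mapDomain_single

lemma toTorus_injective (hA : (ratMatrix A).det ≠ 0) : Function.Injective (toTorus A) :=
  AddMonoidAlgebra.mapDomain_injective (expo_injective hA)

lemma toTorus_potential (hA : (ratMatrix A).det ≠ 0) :
    toTorus A (potential A.transpose) = coordSum n := by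
  simp only [potential, map_sum, prod_X_pow_eq_monomial, toTorus_monomial, coordSum, expo_col hA]

/-- The exponent vector `(k, …, k)`. -/
def allOnes (n k : ℕ) : Fin (n + 1) →₀ ℕ := Finsupp.equivFunOnFinite.symm fun _ => k

@[simp]
lemma allOnes_apply (k : ℕ) (j : Fin (n + 1)) : allOnes n k j = k := rfl

/-! ### Clearing denominators and contracting the ideal -/

lemma exists_expo_eq (hA : (ratMatrix A).det ≠ 0) {v : Fin (n + 1) → ℚ}
    (hv : ∀ i, ∃ z : ℤ, (ratMatrix A).mulVec v i = z) :
    ∃ k₀, ∀ k ≥ k₀, ∃ m, expo A m = expo A (allOnes n k) + v := by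
  choose z hz using hv
  refine ⟨∑ i, (z i).natAbs, fun k hk => ?_⟩
  -- `toNat` truncates nothing: `k` is at least every `|z i|`.
  refine ⟨Finsupp.equivFunOnFinite.symm fun i => (k + z i).toNat, ?_⟩
  apply mulVec_injective hA
  rw [Matrix.mulVec_add, mulVec_expo hA, mulVec_expo hA]
  ext i
  have hi : (z i).natAbs ≤ k :=
    (Finset.single_le_sum (f := fun i => (z i).natAbs) (fun _ _ => Nat.zero_le _)
      (Finset.mem_univ i)).trans hk
  have h0 : 0 ≤ k + z i := by omega
  rw [Pi.add_apply, hz i]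
  calc (((k + z i).toNat : ℕ) : ℚ) = (((k + z i).toNat : ℤ) : ℚ) := (Int.cast_natCast _).symm
    _ = k + z i := by rw [Int.toNat_of_nonneg h0, Int.cast_add, Int.cast_natCast]

lemma exists_toTorus_eq (hA : (ratMatrix A).det ≠ 0) (h : TorusRing n)
    (hh : ∀ v ∈ h.coeff.support, ∀ i, ∃ z : ℤ, (ratMatrix A).mulVec v i = z) :
    ∃ k p, toTorus A p = AddMonoidAlgebra.single (expo A (allOnes n k)) 1 * h := by
  classical
  have hk : ∀ v : h.coeff.support, ∃ k₀, ∀ k ≥ k₀, ∃ m, expo A m = expo A (allOnes n k) + v :=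
    fun v => exists_expo_eq hA (hh v v.2)
  choose k₀ hk₀ using hk
  have hk : ∀ v : h.coeff.support, ∃ m, expo A m = expo A (allOnes n (∑ v, k₀ v)) + v :=
    fun v => hk₀ v _ (Finset.single_le_sum (f := k₀) (fun _ _ => Nat.zero_le _)
      (Finset.mem_univ v))
  choose m hm using hk
  refine ⟨∑ v, k₀ v, ∑ v : h.coeff.support, monomial (m v) (h.coeff v), ?_⟩
  have hsum : h = ∑ v : h.coeff.support, AddMonoidAlgebra.single (v : Fin (n + 1) → ℚ)
      (h.coeff v) := by
    rw [Finset.sum_coe_sort h.coeff.support fun v => AddMonoidAlgebra.single v (h.coeff v)]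
    apply AddMonoidAlgebra.coeff_injective
    conv_lhs => rw [← Finsupp.sum_single h.coeff]
    simp [Finsupp.sum]
  refine Eq.trans ?_ (congrArg (AddMonoidAlgebra.single _ 1 * ·) hsum.symm)
  simp only [map_sum, toTorus_monomial, Finset.mul_sum, AddMonoidAlgebra.single_mul_single,
    one_mul, hm]

/-- The part of an element of the ring of the torus supported on a set of exponents. -/
def torusFilter (Λ : Set (Fin (n + 1) → ℚ)) (h : TorusRing n) : TorusRing n :=
  open Classical in .ofCoeff (h.coeff.filter (· ∈ Λ))

/-- Multiplication by the coordinate sum shifts exponents by vectors of `Λ`, so it preserves each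
coset of `Λ`. -/
lemma coordSum_mul_torusFilter (Λ : AddSubgroup (Fin (n + 1) → ℚ))
    (hΛ : ∀ i, Pi.single i 1 ∈ Λ) (h : TorusRing n) :
    coordSum n * torusFilter Λ h = torusFilter Λ (coordSum n * h) := by
  classical
  have hc : ∀ (g : TorusRing n) v,
      (coordSum n * g).coeff v = ∑ i, g.coeff (-Pi.single i 1 + v) := by
    intro g v
    simp [coordSum, Finset.sum_mul]
  apply AddMonoidAlgebra.coeff_injective
  ext v
  rw [hc]
  simp only [torusFilter, Finsupp.filter_apply, hc]
  have hmem : ∀ i, -Pi.single i 1 + v ∈ (Λ : Set (Fin (n + 1) → ℚ)) ↔ v ∈ (Λ : Set _) :=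
    fun i => Λ.add_mem_cancel_left (neg_mem (hΛ i))
  simp only [hmem]
  split_ifs <;> simp

variable (A) in
/-- The vectors which `A` maps to integer vectors. -/
def integralLattice : AddSubgroup (Fin (n + 1) → ℚ) where
  carrier := {v | ∀ i, ∃ z : ℤ, (ratMatrix A).mulVec v i = z}
  zero_mem' i := ⟨0, by simp⟩
  add_mem' {v w} hv hw i := by
    obtain ⟨a, ha⟩ := hv i
    obtain ⟨b, hb⟩ := hw i
    exact ⟨a + b, by rw [Matrix.mulVec_add, Pi.add_apply, ha, hb, Int.cast_add]⟩
  neg_mem' {v} hv i := by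
    obtain ⟨a, ha⟩ := hv i
    exact ⟨-a, by rw [Matrix.mulVec_neg, Pi.neg_apply, ha, Int.cast_neg]⟩

lemma expo_mem_integralLattice (hA : (ratMatrix A).det ≠ 0) (m : Fin (n + 1) →₀ ℕ) :
    expo A m ∈ integralLattice A :=
  fun i => ⟨m i, by rw [mulVec_expo hA]; simp⟩

lemma torusFilter_toTorus (hA : (ratMatrix A).det ≠ 0) (p : MvPolynomial (Fin (n + 1)) ℂ) :
    torusFilter (integralLattice A) (toTorus A p) = toTorus A p := by
  classical
  apply AddMonoidAlgebra.coeff_injective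
  change Finsupp.filter _ (Finsupp.mapDomain _ _) = Finsupp.mapDomain _ _
  rw [Finsupp.filter_eq_self_iff]
  intro v hv
  have := Finsupp.mapDomain_support (Finsupp.mem_support_iff.mpr hv)
  obtain ⟨m, -, rfl⟩ := Finset.mem_image.mp this
  exact expo_mem_integralLattice hA m

/-- Setting `x_j = 0` and the other variables to `1` turns `F_{A^T}` into the number of its
monomials free of `x_j`, which is nonzero. So `F_{A^T}` is coprime to every variable, and monomial
factors cancel. -/
lemma potential_transpose_dvd (h0 : ∀ i, ∃ l, A i l = 0)
    {p : MvPolynomial (Fin (n + 1)) ℂ} {k : ℕ}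
    (h : potential A.transpose ∣ monomial (allOnes n k) 1 * p) : potential A.transpose ∣ p := by
  classical
  refine IsRelPrime.dvd_of_dvd_mul_left ?_ h
  rw [allOnes, ← prod_X_pow_eq_monomial]
  refine IsRelPrime.prod_right fun j _ => IsRelPrime.pow_right (IsRelPrime.symm ?_)
  rw [Irreducible.isRelPrime_iff_not_dvd (X_prime (R := ℂ) (i := j)).irreducible]
  rintro ⟨c, hc⟩
  have hev := congrArg (eval (Function.update 1 j 0 : Fin (n + 1) → ℂ)) hc
  rw [eval_potential, map_mul, eval_X, Function.update_self, zero_mul] at hev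
  have hterm : ∀ i, ∏ l, (Function.update 1 j 0 : Fin (n + 1) → ℂ) l ^ A.transpose i l
      = if A j i = 0 then 1 else 0 := by
    intro i
    rw [Finset.prod_eq_single j]
    · by_cases hji : A j i = 0 <;> simp [hji]
    · intro l _ hl
      simp [hl]
    · simp
  simp only [hterm, Finset.sum_boole, Nat.cast_eq_zero, Finset.card_eq_zero] at hev
  obtain ⟨l, hl⟩ := h0 j
  exact Finset.notMem_empty l (hev ▸ Finset.mem_filter.mpr ⟨Finset.mem_univ l, hl⟩)

/-- The quotient may have arbitrary rational exponents. Projecting it to `integralLattice A` makes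
it a Laurent polynomial in the `x_j`; a monomial factor then clears its denominators and is
cancelled. -/
lemma potential_transpose_dvd_of_toTorus (hA : (ratMatrix A).det ≠ 0) (h0 : ∀ i, ∃ l, A i l = 0)
    {p : MvPolynomial (Fin (n + 1)) ℂ} (h : coordSum n ∣ toTorus A p) :
    potential A.transpose ∣ p := by
  obtain ⟨g, hg⟩ := h
  have hg' : toTorus A p = coordSum n * torusFilter (integralLattice A) g := by
    rw [coordSum_mul_torusFilter, ← hg, torusFilter_toTorus hA]
    intro i
    rw [← expo_col hA]
    exact expo_mem_integralLattice hA _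
  obtain ⟨k, r, hr⟩ := exists_toTorus_eq hA (torusFilter (integralLattice A) g) <| by
    classical
    intro v hv
    have : v ∈ (integralLattice A : Set _) := by
      by_contra hv'
      exact Finsupp.mem_support_iff.mp hv (Finsupp.filter_apply_neg _ _ hv')
    exact this
  refine potential_transpose_dvd h0 (k := k) ⟨r, toTorus_injective hA ?_⟩
  rw [map_mul, map_mul, toTorus_monomial, toTorus_potential hA, hg', hr]
  ring

/-- The homomorphism from the coordinate ring of the transposed hypersurface. -/
def coordToTorus (hA : (ratMatrix A).det ≠ 0) :
    CoordRing A.transpose →ₐ[ℂ] TorusHypersurface n :=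
  Ideal.quotientMapₐ _ (toTorus A) <| by
    rw [Ideal.span_singleton_le_iff_mem, Ideal.mem_comap]
    exact (toTorus_potential hA).symm ▸ Ideal.mem_span_singleton_self _

lemma coordToTorus_toCoordRing (hA : (ratMatrix A).det ≠ 0) (p : MvPolynomial (Fin (n + 1)) ℂ) :
    coordToTorus hA (toCoordRing A.transpose p) = Ideal.Quotient.mkₐ ℂ _ (toTorus A p) :=
  rfl

lemma coordToTorus_monomial (hA : (ratMatrix A).det ≠ 0) (m : Fin (n + 1) →₀ ℕ) (c : ℂ) :
    coordToTorus hA (toCoordRing A.transpose (monomial m c)) = c • torusMonomial (expo A m) := by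
  rw [coordToTorus_toCoordRing, toTorus_monomial, torusMonomial, ← map_smul,
    AddMonoidAlgebra.smul_single, smul_eq_mul, mul_one]

lemma coordToTorus_injective (hA : (ratMatrix A).det ≠ 0) (h0 : ∀ i, ∃ l, A i l = 0) :
    Function.Injective (coordToTorus hA) := by
  rw [injective_iff_map_eq_zero]
  intro s hs
  obtain ⟨p, rfl⟩ : ∃ p, toCoordRing A.transpose p = s := Ideal.Quotient.mk_surjective s
  rw [coordToTorus_toCoordRing] at hs
  have hs' := Ideal.mem_span_singleton.mp (Ideal.Quotient.eq_zero_iff_mem.mp hs)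
  exact Ideal.Quotient.eq_zero_iff_mem.mpr
    (Ideal.mem_span_singleton.mpr (potential_transpose_dvd_of_toTorus hA h0 hs'))

/-! ### Invariant monomials -/

lemma coeff_scale (l : Fin (n + 1) → ℂˣ) (p : MvPolynomial (Fin (n + 1)) ℂ)
    (m : Fin (n + 1) →₀ ℕ) : coeff m (scale l p) = (∏ j, l j ^ m j : ℂˣ) * coeff m p := by
  classical
  induction p using MvPolynomial.induction_on' with
  | add p q hp hq => rw [map_add, coeff_add, coeff_add, hp, hq, mul_add]
  | monomial u c =>
    have : scale l (monomial u c) = monomial u ((∏ j, l j ^ u j : ℂˣ) * c) := by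
      rw [scale, aeval_monomial, Finsupp.prod_fintype _ _ (by simp), monomial_eq,
        Finsupp.prod_fintype _ _ (by simp)]
      simp only [mul_pow, Finset.prod_mul_distrib, algebraMap_eq, map_mul, map_prod, map_pow,
        Units.coe_prod, Units.val_pow_eq_pow_val]
      ring
    rw [this, coeff_monomial, coeff_monomial]
    split_ifs with h
    · rw [h]
    · rw [mul_zero]

/-- A diagonal automorphism preserves all the monomials of the potential. -/
lemma prod_pow_row_eq_one {l : Fin (n + 1) → ℂˣ} (hl : l ∈ diagAut A) (i : Fin (n + 1)) :
    ∏ j, l j ^ A i j = 1 := by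
  classical
  have h := coeff_scale l (potential A) (Finsupp.equivFunOnFinite.symm (A i))
  rw [scale_potential hl] at h
  have hne : coeff (Finsupp.equivFunOnFinite.symm (A i)) (potential A) ≠ 0 := by
    simp only [potential, prod_X_pow_eq_monomial, coeff_sum, coeff_monomial, Finset.sum_boole,
      Nat.cast_ne_zero, ne_eq, Finset.card_eq_zero]
    intro h0
    exact Finset.notMem_empty i (h0 ▸ Finset.mem_filter.mpr ⟨Finset.mem_univ i, rfl⟩)
  have h1 := mul_right_cancel₀ hne ((one_mul _).trans h)
  exact Units.ext h1.symm

/-- The dual of the lattice of exponents of the `G`-invariant Laurent monomials. -/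
def dualLattice (G : Subgroup (Fin (n + 1) → ℂˣ)) : AddSubgroup (Fin (n + 1) → ℚ) where
  carrier := {v | ∀ s : Fin (n + 1) → ℤ, (∀ g ∈ G, ∏ i, g i ^ s i = 1) →
    ∃ z : ℤ, ∑ i, s i * v i = z}
  zero_mem' s _ := ⟨0, by simp⟩
  add_mem' {v w} hv hw s hs := by
    obtain ⟨a, ha⟩ := hv s hs
    obtain ⟨b, hb⟩ := hw s hs
    exact ⟨a + b, by simp [mul_add, Finset.sum_add_distrib, ha, hb]⟩
  neg_mem' {v} hv s hs := by
    obtain ⟨a, ha⟩ := hv s hs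
    exact ⟨-a, by simp [ha]⟩

/-- The rows of `A` are themselves exponents of `G`-invariant monomials. -/
lemma dualLattice_le_integralLattice {G : Subgroup (Fin (n + 1) → ℂˣ)} (hG : G ≤ diagAut A) :
    dualLattice G ≤ integralLattice A := by
  intro v hv i
  obtain ⟨z, hz⟩ := hv (fun j => A i j) fun g hg => by
    simpa using prod_pow_row_eq_one (hG hg) i
  exact ⟨z, by simpa [Matrix.mulVec, dotProduct] using hz⟩

lemma ratMatrix_transpose_inv :
    (ratMatrix A.transpose)⁻¹ = (ratMatrix A)⁻¹.transpose := by
  rw [Matrix.transpose_nonsing_inv]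
  rfl

lemma prod_rho_zpow (s : Fin (n + 1) → ℤ) (m : Fin (n + 1) →₀ ℕ) :
    ((∏ j, (∏ i, rho A.transpose i ^ s i) j ^ m j : ℂˣ) : ℂ)
      = Complex.exp ((∑ i, s i * expo A m i : ℚ) * (2 * Real.pi * Complex.I)) := by
  have h : ∀ i j, ((rho A.transpose i j : ℂˣ) : ℂ)
      = Complex.exp (((ratMatrix A)⁻¹ i j : ℚ) * (2 * Real.pi * Complex.I)) := by
    intro i j
    rw [rho, Units.val_mk0, ratMatrix_transpose_inv, Matrix.transpose_apply, mul_comm]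
  simp only [Units.coe_prod, Units.val_pow_eq_pow_val, Finset.prod_apply, Pi.pow_apply,
    Units.val_zpow_eq_zpow_val, h, ← Complex.exp_int_mul, ← Complex.exp_sum,
    ← Complex.exp_nat_mul]
  congr 1
  have hexpo : ∀ i, expo A m i = ∑ j, (ratMatrix A)⁻¹ i j * m j := fun i => rfl
  simp only [hexpo]
  push_cast
  simp only [Finset.mul_sum, Finset.sum_mul]
  rw [Finset.sum_comm]
  exact Finset.sum_congr rfl fun i _ => Finset.sum_congr rfl fun j _ => by ring

/-- The element `∏ (ρ_i^T)^(s_i)` multiplies `x^m` by `exp(2πi s·A⁻¹m)`, which is `1` exactly when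
`s·A⁻¹m` is an integer. -/
lemma mem_dualLattice_iff (G : Subgroup (Fin (n + 1) → ℂˣ)) (m : Fin (n + 1) →₀ ℕ) :
    expo A m ∈ dualLattice G ↔ ∀ l ∈ dualGroup A G, ∏ j, l j ^ m j = 1 := by
  have key : ∀ s : Fin (n + 1) → ℤ, (∃ z : ℤ, ∑ i, s i * expo A m i = z) ↔
      ∏ j, (∏ i, rho A.transpose i ^ s i) j ^ m j = 1 := by
    intro s
    rw [← Units.val_inj, prod_rho_zpow, Units.val_one, Complex.exp_eq_one_iff]
    refine exists_congr fun z => ?_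
    rw [mul_left_inj' Complex.two_pi_I_ne_zero]
    norm_cast
  constructor
  · rintro h _ ⟨s, hs, rfl⟩
    exact (key s).mp (h s hs)
  · intro h s hs
    exact (key s).mpr (h _ ⟨s, hs, rfl⟩)

variable (A) in
/-- Some power of each variable has an exponent vector in all the dual lattices. -/
lemma exists_expo_single_mem : ∃ D, 0 < D ∧ ∀ (G : Subgroup (Fin (n + 1) → ℂˣ)) (j : Fin (n + 1)),
    expo A (Finsupp.single j D) ∈ dualLattice G := by
  -- `D` is a common denominator of the entries of `A⁻¹`, so the exponent of `x_j ^ D` is an integer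
  -- vector.
  obtain ⟨D, hD, hz⟩ := exists_pos_mul_int
    fun p : Fin (n + 1) × Fin (n + 1) => (ratMatrix A)⁻¹ p.1 p.2
  choose z hz using hz
  refine ⟨D, hD, fun G j s _ => ⟨∑ i, s i * z (i, j), ?_⟩⟩
  push_cast
  refine Finset.sum_congr rfl fun i _ => ?_
  rw [← hz]
  congr 1
  change ∑ k, (ratMatrix A)⁻¹ i k * (Finsupp.single j D k : ℕ) = _
  rw [Finset.sum_eq_single j]
  · rw [Finsupp.single_eq_same, mul_comm]
  · intro k _ hk
    rw [Finsupp.single_eq_of_ne hk, Nat.cast_zero, mul_zero]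
  · simp

lemma allOnes_eq_sum (D : ℕ) : allOnes n D = ∑ j, Finsupp.single j D := by
  ext i
  simp [Finsupp.single_apply]

/-- Invariance of `x_j ^ D` makes every coordinate a `D`-th root of unity. Finiteness is what
permits averaging over the group. -/
lemma finite_dualGroup (A : Matrix (Fin (n + 1)) (Fin (n + 1)) ℕ)
    (G : Subgroup (Fin (n + 1) → ℂˣ)) : Finite (dualGroup A G) := by
  obtain ⟨D, hD, h⟩ := exists_expo_single_mem A
  have hroot : ∀ l ∈ dualGroup A G, ∀ j, l j ∈ rootsOfUnity D ℂ := by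
    intro l hl j
    have := (mem_dualLattice_iff G _).mp (h G j) l hl
    rw [Finset.prod_eq_single j] at this
    · simpa [mem_rootsOfUnity] using this
    · intro k _ hk
      rw [Finsupp.single_eq_of_ne hk, pow_zero]
    · simp
  have : NeZero D := ⟨hD.ne'⟩
  exact Finite.of_injective
    (fun l : dualGroup A G => fun j => (⟨l.1 j, hroot l.1 l.2 j⟩ : rootsOfUnity D ℂ))
    fun a b hab => Subtype.ext (funext fun j => congrArg Subtype.val (congrFun hab j))

/-- An invariant class has a representative all of whose monomials are invariant. -/
lemma exists_invariant_representative {G : Subgroup (Fin (n + 1) → ℂˣ)}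
    (hG : G ≤ diagAut A) [Finite G] (p : MvPolynomial (Fin (n + 1)) ℂ)
    (hp : toCoordRing A p ∈ invariants A G hG) :
    ∃ p', toCoordRing A p' = toCoordRing A p ∧ p'.support ⊆ p.support ∧
      ∀ m ∈ p'.support, ∀ l ∈ G, ∏ j, l j ^ m j = 1 := by
  classical
  have := Fintype.ofFinite G
  have hcard : (Fintype.card G : ℂ) ≠ 0 := Nat.cast_ne_zero.mpr Fintype.card_ne_zero
  rw [mem_invariants] at hp
  have hcoeff : ∀ m, coeff m ((Fintype.card G : ℂ)⁻¹ • ∑ l : G, scale l.1 p)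
      = (Fintype.card G : ℂ)⁻¹ * ((∑ l : G, ((∏ j, l.1 j ^ m j : ℂˣ) : ℂ)) * coeff m p) := by
    intro m
    simp only [coeff_smul, coeff_sum, coeff_scale, smul_eq_mul, Finset.sum_mul]
  -- Averaging over `G` multiplies the coefficient at `m` by the mean of the character `l ↦ l^m`,
  -- which vanishes unless that character is trivial.
  refine ⟨(Fintype.card G : ℂ)⁻¹ • ∑ l : G, scale l.1 p, ?_, ?_, ?_⟩
  · rw [map_smul, map_sum]
    have : ∀ l : G, toCoordRing A (scale l.1 p) = toCoordRing A p := fun l =>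
      (coordAct_toCoordRing A ⟨l.1, hG l.2⟩ p).symm.trans (hp l.1 l.2)
    simp only [this, Finset.sum_const, Finset.card_univ]
    rw [← Nat.cast_smul_eq_nsmul ℂ, smul_smul, inv_mul_cancel₀ hcard, one_smul]
  · intro m hm
    rw [mem_support_iff, hcoeff] at hm
    exact mem_support_iff.mpr (right_ne_zero_of_mul (right_ne_zero_of_mul hm))
  · intro m hm
    rw [mem_support_iff, hcoeff] at hm
    let χ : G →* ℂ :=
      { toFun := fun l => ((∏ j, l.1 j ^ m j : ℂˣ) : ℂ)
        map_one' := by simp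
        map_mul' := fun a b => by simp [mul_pow, Finset.prod_mul_distrib] }
    have hχ : χ = 1 := by
      by_contra hne
      exact left_ne_zero_of_mul (right_ne_zero_of_mul hm) (sum_hom_units_eq_zero χ hne)
    intro l hl
    exact Units.ext (DFunLike.congr_fun hχ ⟨l, hl⟩)

/-- The invariant class of a monomial with exponent in the dual lattice. -/
def invariantMonomial (hA : (ratMatrix A).det ≠ 0) {G : Subgroup (Fin (n + 1) → ℂˣ)}
    (m : Fin (n + 1) →₀ ℕ) (hm : expo A m ∈ dualLattice G) :
    invariants A.transpose (dualGroup A G) (dualGroup_le_diagAut hA G) :=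
  ⟨toCoordRing A.transpose (monomial m 1), by
    rw [mem_invariants]
    intro l hl
    rw [coordAct_toCoordRing]
    congr 1
    ext u
    rw [coeff_scale, coeff_monomial]
    split_ifs with hu
    · subst hu
      rw [(mem_dualLattice_iff G _).mp hm l hl, Units.val_one, one_mul]
    · rw [mul_zero]⟩

/-! ### Degree-zero invariant fractions -/

/-- Since `r A = (e, …, e)`, one has `r·m = (r A)·(A⁻¹ m)`. In particular, having degree zero is a
condition on `A⁻¹ m` independent of the weights. -/
lemma weight_eq (hA : (ratMatrix A).det ≠ 0) {r : Fin (n + 1) → ℕ} {e : ℕ}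
    (hr : IsWeightSystem A.transpose r e) (m : Fin (n + 1) →₀ ℕ) :
    (Finsupp.weight r m : ℚ) = e * ∑ i, expo A m i := by
  have h1 : ∀ i, ∑ j, (A j i : ℚ) * r j = e := fun i => by exact_mod_cast hr.sum_eq i
  have h2 : ∀ j, (m j : ℚ) = ∑ i, (A j i : ℚ) * expo A m i := fun j =>
    (congrFun (mulVec_expo hA m) j).symm
  rw [Finsupp.weight_apply, Finsupp.sum_fintype _ _ (by simp), Finset.mul_sum]
  push_cast
  simp only [smul_eq_mul, Nat.cast_mul, h2, Finset.sum_mul]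
  rw [Finset.sum_comm]
  refine Finset.sum_congr rfl fun i _ => ?_
  rw [← h1 i, Finset.sum_mul]
  exact Finset.sum_congr rfl fun j _ => by ring

lemma invariantMonomial_mem (hA : (ratMatrix A).det ≠ 0) {G : Subgroup (Fin (n + 1) → ℂˣ)}
    {m : Fin (n + 1) →₀ ℕ} (hm : expo A m ∈ dualLattice G) {r : Fin (n + 1) → ℕ} {k : ℕ}
    (hk : Finsupp.weight r m = k) :
    invariantMonomial hA m hm ∈
      invariantGrading A.transpose r (dualGroup A G) (dualGroup_le_diagAut hA G) k :=
  ⟨monomial m 1, isWeightedHomogeneous_monomial r m 1 hk, rfl⟩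

/-- The homomorphism from the ring of invariants of the transposed hypersurface. -/
def invariantsToTorus (hA : (ratMatrix A).det ≠ 0) (G : Subgroup (Fin (n + 1) → ℂˣ)) :
    invariants A.transpose (dualGroup A G) (dualGroup_le_diagAut hA G) →ₐ[ℂ]
      TorusHypersurface n :=
  (coordToTorus hA).comp (Subalgebra.val _)

lemma invariantsToTorus_invariantMonomial (hA : (ratMatrix A).det ≠ 0)
    {G : Subgroup (Fin (n + 1) → ℂˣ)} (m : Fin (n + 1) →₀ ℕ) (hm : expo A m ∈ dualLattice G) :
    invariantsToTorus hA G (invariantMonomial hA m hm) = torusMonomial (expo A m) := by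
  rw [← one_smul ℂ (torusMonomial _)]
  exact coordToTorus_monomial hA m 1

/-- The functions on the torus hypersurface which are of degree zero and have exponents in the dual
lattice of `G`. -/
def degreeZeroFunctions (G : Subgroup (Fin (n + 1) → ℂˣ)) : Submodule ℂ (TorusHypersurface n) :=
  Submodule.span ℂ (torusMonomial '' {v | v ∈ dualLattice G ∧ ∑ i, v i = 0})

/-- A numerator may be taken with invariant monomials only, and dividing by a power of `∏ x_j ^ D`
leaves exponents in `dualLattice G` with coordinate sum zero. Conversely, multiplying `X^v` by a
high power of the same denominator makes it an invariant monomial in the `x_j`. -/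
lemma fractions_eq_degreeZeroFunctions (hA : (ratMatrix A).det ≠ 0)
    {G : Subgroup (Fin (n + 1) → ℂˣ)} (hG : G ≤ diagAut A) {r : Fin (n + 1) → ℕ} {e : ℕ}
    (hr : IsWeightSystem A.transpose r e) {D N : ℕ} (hD : 0 < D)
    (hDG : expo A (allOnes n D) ∈ dualLattice G) (hN : Finsupp.weight r (allOnes n D) = N) :
    letI := invariantGradedAlgebra hr (dualGroup A G) (dualGroup_le_diagAut hA G)
    fractions _ (invariantsToTorus hA G) (invariantMonomial_mem hA hDG hN)
      = degreeZeroFunctions G := by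
  let := invariantGradedAlgebra hr (dualGroup A G) (dualGroup_le_diagAut hA G)
  have he : (e : ℚ) ≠ 0 := by exact_mod_cast hr.degree_pos.ne'
  apply le_antisymm
  · rintro y ⟨k, a, ⟨p, hp, hpa⟩, hy⟩
    have := finite_dualGroup A G
    have hpa' : toCoordRing A.transpose p = a.1 := hpa
    obtain ⟨p', hp'p, hsupp, hinv⟩ := exists_invariant_representative
      (dualGroup_le_diagAut hA G) p (by rw [hpa']; exact a.2)
    have ha : invariantsToTorus hA G a =
        ∑ m ∈ p'.support, coeff m p' • torusMonomial (expo A m) := by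
      change coordToTorus hA a.1 = _
      rw [← hpa', ← hp'p]
      conv_lhs => rw [← support_sum_monomial_coeff p', map_sum, map_sum]
      exact Finset.sum_congr rfl fun m _ => coordToTorus_monomial hA m _
    have hy' : y = ∑ m ∈ p'.support,
        coeff m p' • torusMonomial (expo A m - k • expo A (allOnes n D)) := by
      rw [invariantsToTorus_invariantMonomial] at hy
      apply ((isUnit_torusMonomial (expo A (allOnes n D))).pow k).mul_right_cancel
      rw [← hy, ha, Finset.sum_mul]
      refine Finset.sum_congr rfl fun m _ => ?_
      rw [smul_mul_assoc, ← torusMonomial_nsmul, ← torusMonomial_add, sub_add_cancel]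
    rw [hy']
    refine sum_mem fun m hm => Submodule.smul_mem _ _ (Submodule.subset_span ⟨_, ⟨?_, ?_⟩, rfl⟩)
    · exact sub_mem ((mem_dualLattice_iff G m).mpr (hinv m hm)) (nsmul_mem hDG k)
    · have hw : Finsupp.weight r m = k • N := hp (mem_support_iff.mp (hsupp hm))
      have h1 := weight_eq hA hr m
      have h2 := weight_eq hA hr (allOnes n D)
      rw [hw] at h1
      rw [hN] at h2
      apply mul_left_cancel₀ he
      simp only [Pi.sub_apply, Pi.smul_apply, Finset.sum_sub_distrib, ← Finset.smul_sum]
      rw [mul_sub, ← h1, mul_smul_comm, ← h2]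
      simp
  · rw [degreeZeroFunctions, Submodule.span_le]
    rintro _ ⟨v, ⟨hv, hv0⟩, rfl⟩
    obtain ⟨k, hk⟩ := exists_expo_eq hA (dualLattice_le_integralLattice hG hv)
    -- Using `k * D` in place of `k` keeps the denominator a power of the chosen `∏ x_j ^ D`.
    obtain ⟨m, hm⟩ := hk (k * D) (Nat.le_mul_of_pos_right k hD)
    have hones : allOnes n (k * D) = k • allOnes n D := by
      ext
      simp
    rw [hones, map_nsmul] at hm
    have hmG : expo A m ∈ dualLattice G := by
      rw [hm]
      exact add_mem (nsmul_mem hDG k) hv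
    refine ⟨k, invariantMonomial hA m hmG, invariantMonomial_mem hA hmG ?_, ?_⟩
    · have h1 := weight_eq hA hr m
      have h2 := weight_eq hA hr (allOnes n D)
      rw [hN] at h2
      rw [hm] at h1
      simp only [Pi.add_apply, Pi.smul_apply, Finset.sum_add_distrib, ← Finset.smul_sum, hv0,
        add_zero, mul_smul_comm, ← h2] at h1
      rw [← Nat.cast_inj (R := ℚ), h1]
      simp
    · rw [invariantsToTorus_invariantMonomial, invariantsToTorus_invariantMonomial, hm,
        torusMonomial_add, torusMonomial_nsmul, mul_comm]

/-- The birational class of the mirror quotient depends only on the group. -/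
theorem birationalOver_orbifold {A' : Matrix (Fin (n + 1)) (Fin (n + 1)) ℕ}
    (hA : (ratMatrix A).det ≠ 0) (hA' : (ratMatrix A').det ≠ 0)
    (h0 : ∀ i, ∃ l, A i l = 0) (h0' : ∀ i, ∃ l, A' i l = 0)
    {G : Subgroup (Fin (n + 1) → ℂˣ)} (hG : G ≤ diagAut A) (hG' : G ≤ diagAut A')
    {r r' : Fin (n + 1) → ℕ} {e e' : ℕ}
    (hr : IsWeightSystem A.transpose r e) (hr' : IsWeightSystem A'.transpose r' e') :
    Scheme.BirationalOver
      (orbifoldToSpec hr (dualGroup A G) (dualGroup_le_diagAut hA G))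
      (orbifoldToSpec hr' (dualGroup A' G) (dualGroup_le_diagAut hA' G)) := by
  let := invariantGradedAlgebra hr (dualGroup A G) (dualGroup_le_diagAut hA G)
  let := invariantGradedAlgebra hr' (dualGroup A' G) (dualGroup_le_diagAut hA' G)
  have hpos : ∀ {q : Fin (n + 1) → ℕ} {D : ℕ}, (∀ j, 0 < q j) → 0 < D →
      0 < Finsupp.weight q (allOnes n D) := by
    intro q D hq hD
    rw [Finsupp.weight_apply, Finsupp.sum_fintype _ _ (by simp)]
    exact Finset.sum_pos (fun j _ => mul_pos hD (hq j)) Finset.univ_nonempty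
  obtain ⟨D, hD, hDG⟩ := exists_expo_single_mem A
  obtain ⟨D', hD', hDG'⟩ := exists_expo_single_mem A'
  have hDG : expo A (allOnes n D) ∈ dualLattice G := by
    rw [allOnes_eq_sum, map_sum]
    exact sum_mem fun j _ => hDG G j
  have hDG' : expo A' (allOnes n D') ∈ dualLattice G := by
    rw [allOnes_eq_sum, map_sum]
    exact sum_mem fun j _ => hDG' G j
  refine birationalOver_of_fractions_eq
    (invariantGrading A.transpose r (dualGroup A G) (dualGroup_le_diagAut hA G))
    (invariantGrading A'.transpose r' (dualGroup A' G) (dualGroup_le_diagAut hA' G))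
    (χ := invariantsToTorus hA G) (χ' := invariantsToTorus hA' G)
    ((coordToTorus_injective hA h0).comp Subtype.val_injective)
    ((coordToTorus_injective hA' h0').comp Subtype.val_injective)
    ?_ ?_ (invariantMonomial_mem hA hDG rfl) (invariantMonomial_mem hA' hDG' rfl)
    (hpos hr.weight_pos hD) (hpos hr'.weight_pos hD') ?_
  · rw [invariantsToTorus_invariantMonomial]
    exact isUnit_torusMonomial _
  · rw [invariantsToTorus_invariantMonomial]
    exact isUnit_torusMonomial _
  · rw [fractions_eq_degreeZeroFunctions hA hG hr hD hDG rfl,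
      fractions_eq_degreeZeroFunctions hA' hG' hr' hD' hDG' rfl]

end

end BHK

theorem theorem1p1 (n : ℕ) (hn : 2 ≤ n)
    (A A' : Matrix (Fin (n + 1)) (Fin (n + 1)) ℕ)
    (q q' : Fin (n + 1) → ℕ) (d d' : ℕ)
    (hA : BHK.IsCalabiYauPotential A q d) (hA' : BHK.IsCalabiYauPotential A' q' d')
    (G G' : Subgroup (Fin (n + 1) → ℂˣ))
    (hJ : BHK.groupJ A q ≤ G) (hSL : G ≤ BHK.diagSL A)
    (hJ' : BHK.groupJ A' q' ≤ G') (hSL' : G' ≤ BHK.diagSL A')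
    (hGG' : G = G') :
    (∃ r e, BHK.IsWeightSystem A.transpose r e) ∧
    (∃ r' e', BHK.IsWeightSystem A'.transpose r' e') ∧
    ∀ (r r' : Fin (n + 1) → ℕ) (e e' : ℕ) (hr : BHK.IsWeightSystem A.transpose r e)
      (hr' : BHK.IsWeightSystem A'.transpose r' e'),
      Scheme.BirationalOver
        (BHK.orbifoldToSpec hr (BHK.dualGroup A G) (BHK.dualGroup_le_diagAut hA.det_ne_zero G))
        (BHK.orbifoldToSpec hr' (BHK.dualGroup A' G')
          (BHK.dualGroup_le_diagAut hA'.det_ne_zero G')) := by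
  subst hGG'
  obtain ⟨σ, t, h⟩ := hA.exists_isChainLoop hn
  obtain ⟨σ', t', h'⟩ := hA'.exists_isChainLoop hn
  refine ⟨h.exists_isWeightSystem_transpose hA.det_ne_zero,
    h'.exists_isWeightSystem_transpose hA'.det_ne_zero, fun r r' e e' hr hr' => ?_⟩
  exact BHK.birationalOver_orbifold hA.det_ne_zero hA'.det_ne_zero (h.exists_entry_eq_zero hn)
    (h'.exists_entry_eq_zero hn) (fun g hg => (hSL hg).1) (fun g hg => (hSL' hg).1) hr hr'
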